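/- **Théorème 3.1 (existence of topological towers).** For every $d\in\mathbb N$ there is $\kappa_d\in\mathbb N$ with the following property. Let $M$ be a compact $d$-dimensional manifold without boundary (of class at least $C^1$, not necessarily connected), equipped with a distance $d(\cdot,\cdot)$ inducing its topology (for instance the distance of a Riemannian metric; points in different components may be at infinite distance). Let $f$ be a $C^1$ diffeomorphism of $M$, let $N_0\in\mathbb N$ and $\delta>0$, and let $K\subset M$ be a compact set with $f(K)=K$ that contains no non-hyperbolic periodic point of (least) period at most $\kappa_d N_0$; a periodic point $x$ of period $p$ is hyperbolic if $D_xf^p$ has no complex eigenvalue of modulus $1$. Let $\mathrm{Per}_{N_0}$ be the set of the periodic points $p\in K$ of period at most $N_0$, and for $p\in M$ put $$W^s_\delta(p)=\{y\in M:\ d(f^n(p),f^n(y))<\delta\ \text{ for all } n\ge 0\},$$ $$W^u_\delta(p)=\{y\in M:\ d(f^{-n}(p),f^{-n}(y))<\delta\ \text{ for all } n\ge 0\}.$$ Then for every $\varepsilon>0$ there is an open set $U\subset M$ such that: 1. for every $x\in K\setminus\bigcup_{p\in \mathrm{Per}_{N_0}}W^s_\delta(p)$ there is $n>0$ with $f^n(x)\in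 U$; 2. for every $x\in K\setminus\bigcup_{p\in \mathrm{Per}_{N_0}}W^u_\delta(p)$ there is $n>0$ with $f^{-n}(x)\in U$; 3. the closed sets $\overline U, f(\overline U),\dots,f^{N_0}(\overline U)$ are pairwise disjoint; 4. if $N_0\ge 1$, every connected component of $\overline U$ has diameter at most $\varepsilon$. -/

import Mathlib

open scoped Manifold ContDiff

/-- `x` is a hyperbolic periodic point of `f`: it is periodic and, `p ≥ 1` being its (least)
period, the differential of `f^p` at `x` has no complex eigenvalue of modulus `1`, that is, its
complexification has no eigenvalue of modulus `1`.
(As `f^p x = x`, source and target of this differential are the same tangent space; in Mathlib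
every tangent space of `M` is a copy of the model space, given by the preferred chart at the
base point.) -/
def IsHyperbolicPeriodicPt {d : ℕ} {M : Type*} [TopologicalSpace M]
    [ChartedSpace (EuclideanSpace ℝ (Fin d)) M] (f : M → M) (x : M) : Prop :=
  x ∈ Function.periodicPts f ∧
    ∀ z : ℂ, Module.End.HasEigenvalue
      ((mfderiv (𝓡 d) (𝓡 d) (f^[Function.minimalPeriod f x]) x :
        EuclideanSpace ℝ (Fin d) →L[ℝ] EuclideanSpace ℝ (Fin d)).toLinearMap.baseChange ℂ) z →
      ‖z‖ ≠ 1

/-- The local stable set of size `δ` of `x`: the points whose forward orbit stays at distance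
less than `δ` from the forward orbit of `x`. The local unstable set of `x` for an invertible map
is its local stable set for the inverse map. -/
def localStableSet {M : Type*} [EMetricSpace M] (f : M → M) (δ : ℝ) (x : M) : Set M :=
  {y | ∀ n : ℕ, edist (f^[n] x) (f^[n] y) < ENNReal.ofReal δ}

/-- The points of the periodic orbits of `f` contained in `K` whose (least) period is at
most `N`. -/
def periodicPtsOfPeriodLE {M : Type*} (f : M → M) (K : Set M) (N : ℕ) : Set M :=
  {p | p ∈ K ∧ p ∈ Function.periodicPts f ∧ Function.minimalPeriod f p ≤ N}

/-!
# Existence of topological towers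

Let `N₀ ≥ 1` and write `R = 2 (L + N₀)`, where `L = towerTime d N₀` is bounded by `N₀` times a
constant depending on `d`.
Hyperbolicity is used only to see that `K` contains finitely many periodic points of period at
most `R`: no power of the differential has the eigenvalue `1`, so that such a point is an isolated
fixed point of every iterate fixing it (`IsHyperbolicPeriodicPt.eventually_iterate_ne`).

An orbit of `K` staying in a small neighbourhood of the finite set of points of period at most `N₀`
from time `1` on lies in one of the local stable sets
(`exists_nhds_forall_iterate_mem_imp_mem_localStableSet`). It is therefore enough to find an open
set `U` with small components, with closure disjoint from its first `N₀` iterates, which is visited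
within bounded time by every orbit starting in a given compact subset `Y` of `K` without points of
period at most `N₀` (`exists_tower_base`).

The set `Y` is covered by finitely many small boxes in charts, each disjoint from its iterates up to
time `R`, and the base `W` of the tower is enlarged box by box. If a point `x` of the current box
does not reach the interior of `W`, an iterate of a small neighbourhood of `x` should be added to
`W` at a time farther than `N₀` from every visit of `x` to `W`. All these visits take place on the
frontier of `W`, and the key point is that their number is bounded in terms of `d` alone. To this
end the faces of all boxes, and of all the cells into which they will be cut, lie on hyperplanes of
grids with rational steps around centres in general position: as the values of `d + 1` chart
coordinates along an orbit form a null set in `ℝ ^ (d + 1)`, no orbit meets the hyperplanes of more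
than `d` of the grids (`exists_generic_centers`). Cutting the box into cells coloured by `2 ^ d`
colours, cells of the same colour being disjoint, and using separate time windows for the different
colours, one avoids conflicts between the added cells (`IsTowerBase.exists_extension`).

The points whose period lies between `N₀` and `R` cannot be put in boxes disjoint from their
iterates. The construction starts from a neighbourhood of representatives of their orbits, whose
frontier in `K` is made to consist of faces of the boxes.
-/

/-! ### Finiteness of the set of hyperbolic periodic points of bounded period -/

/-- A nonzero fixed vector of `A ^ m` yields an eigenvector of the complexification of `A` whose
eigenvalue is an `m`-th root of unity. -/
theorem eq_zero_of_pow_apply_eq_self {E : Type*} [NormedAddCommGroup E] [NormedSpace ℝ E]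
    [FiniteDimensional ℝ E] (A : E →L[ℝ] E)
    (hA : ∀ z : ℂ, Module.End.HasEigenvalue (A.toLinearMap.baseChange ℂ) z → ‖z‖ ≠ 1)
    {m : ℕ} (hm : 0 < m) {v : E} (hv : (A ^ m) v = v) : v = 0 := by
  by_contra hv0
  set T := A.toLinearMap.baseChange ℂ with hT
  have hpow : ∀ n : ℕ, ∀ w : E, (T ^ n) (1 ⊗ₜ[ℝ] w) = 1 ⊗ₜ[ℝ] ((A ^ n) w) := by
    intro n
    induction n with
    | zero => intro w; simp
    | succ n ih =>
      intro w
      rw [pow_succ, pow_succ, Module.End.mul_apply, hT, LinearMap.baseChange_tmul, ← hT, ih]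
      rfl
  have hne : (1 : ℂ) ⊗ₜ[ℝ] v ≠ 0 := by
    intro h0
    apply hv0
    apply Module.FaithfullyFlat.tensorProduct_mk_injective (A := ℝ) (B := ℂ) E
    simpa using h0
  have h1 : Module.End.HasEigenvalue (T ^ m) 1 := by
    apply Module.End.hasEigenvalue_of_hasEigenvector (x := (1 : ℂ) ⊗ₜ[ℝ] v)
    refine ⟨?_, hne⟩
    rw [Module.End.mem_eigenspace_iff, hpow, hv, one_smul]
  rw [Module.End.hasEigenvalue_iff_mem_spectrum, spectrum.map_pow_of_pos _ hm] at h1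
  obtain ⟨z, hz, hz1⟩ := h1
  refine hA z (Module.End.hasEigenvalue_iff_mem_spectrum.2 hz) ?_
  exact Complex.norm_eq_one_of_pow_eq_one hz1 hm.ne'

/-- A hyperbolic periodic point is an isolated fixed point of every iterate that fixes it. -/
theorem IsHyperbolicPeriodicPt.eventually_iterate_ne {d : ℕ} {M : Type*} [TopologicalSpace M]
    [ChartedSpace (EuclideanSpace ℝ (Fin d)) M] {f : M → M} (hf : ContMDiff (𝓡 d) (𝓡 d) 1 f)
    {x : M} (hx : IsHyperbolicPeriodicPt (d := d) f x) {n : ℕ} (hn : 0 < n) (hfx : f^[n] x = x) :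
    ∀ᶠ y in nhdsWithin x {x}ᶜ, f^[n] y ≠ y := by
  set p := Function.minimalPeriod f x with hp
  obtain ⟨m, rfl⟩ : p ∣ n := Function.IsPeriodicPt.minimalPeriod_dvd hfx
  have hm : 0 < m := Nat.pos_of_mul_pos_left hn
  have hgx : f^[p] x = x := Function.iterate_minimalPeriod
  have hg : ContMDiff (𝓡 d) (𝓡 d) 1 f^[p] := hf.iterate p
  set g := f^[p] with hgdef
  set e := chartAt (EuclideanSpace ℝ (Fin d)) x with he
  set A : EuclideanSpace ℝ (Fin d) →L[ℝ] EuclideanSpace ℝ (Fin d) := mfderiv (𝓡 d) (𝓡 d) g x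
    with hA
  set G : EuclideanSpace ℝ (Fin d) → EuclideanSpace ℝ (Fin d) := fun y => e (g (e.symm y)) with hG
  have hxs : x ∈ e.source := mem_chart_source _ x
  have hGA : HasFDerivAt G A (e x) := by
    have h := ((hg x).mdifferentiableAt one_ne_zero).hasMFDerivAt.2
    simp only [writtenInExtChartAt, hgx, modelWithCornersSelf_coe, Set.range_id] at h
    exact hasFDerivWithinAt_univ.1 h
  have hGx : G (e x) = e x := by simp [hG, e.left_inv hxs, hgx]
  have hGm : HasFDerivAt (fun y => G^[m] y - y) (A ^ m - ContinuousLinearMap.id ℝ _) (e x) :=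
    (hGA.iterate hGx m).sub (hasFDerivAt_id _)
  have hanti : ∃ C, AntilipschitzWith C
      (A ^ m - ContinuousLinearMap.id ℝ (EuclideanSpace ℝ (Fin d))) := by
    have hinj : Function.Injective
        (A ^ m - ContinuousLinearMap.id ℝ (EuclideanSpace ℝ (Fin d))).toLinearMap := by
      rw [← LinearMap.ker_eq_bot, LinearMap.ker_eq_bot']
      intro v hv
      refine eq_zero_of_pow_apply_eq_self A hx.2 hm ?_
      exact sub_eq_zero.1 hv
    obtain ⟨C, -, hC⟩ := (LinearMap.injective_iff_antilipschitz _).1 hinj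
    exact ⟨C, hC⟩
  have hev := hGm.eventually_ne (c := 0) hanti
  rw [eventually_nhdsWithin_iff] at hev ⊢
  have hsrc : ∀ j, ∀ᶠ y in nhds x, g^[j] y ∈ e.source := by
    intro j
    apply (hg.continuous.iterate j).continuousAt.eventually_mem
    rw [Function.iterate_fixed hgx]
    exact e.open_source.mem_nhds hxs
  have hsrc' : ∀ᶠ y in nhds x, ∀ j ∈ Finset.range (m + 1), g^[j] y ∈ e.source := by
    rw [Filter.eventually_all_finset]
    exact fun j _ => hsrc j
  filter_upwards [(e.continuousAt hxs).eventually hev, hsrc'] with y hy hys hyx hfy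
  rw [Function.iterate_mul] at hfy
  have hy0 : y ∈ e.source := hys 0 (by simp)
  have hit : ∀ j ≤ m, G^[j] (e y) = e (g^[j] y) := by
    intro j
    induction j with
    | zero => intro _; rfl
    | succ j ih =>
      intro hj
      rw [Function.iterate_succ_apply', Function.iterate_succ_apply', ih (by omega)]
      simp only [hG]
      rw [e.left_inv (hys j (by simp; omega))]
  refine hy (fun h => hyx (e.injOn hy0 hxs h)) ?_
  rw [hit m le_rfl, hfy, sub_self]

theorem finite_periodicPtsOfPeriodLE {d : ℕ} {M : Type*} [TopologicalSpace M] [T2Space M]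
    [ChartedSpace (EuclideanSpace ℝ (Fin d)) M] {f : M → M} (hf : ContMDiff (𝓡 d) (𝓡 d) 1 f)
    {K : Set M} (hK : IsCompact K) {m : ℕ}
    (hyp : ∀ x ∈ periodicPtsOfPeriodLE f K m, IsHyperbolicPeriodicPt (d := d) f x) :
    (periodicPtsOfPeriodLE f K m).Finite := by
  have key : ∀ n ∈ Set.Icc 1 m, {x ∈ K | f^[n] x = x}.Finite := by
    intro n hn
    by_contra hinf
    have hcl : IsClosed {x | f^[n] x = x} :=
      isClosed_eq (hf.continuous.iterate n) continuous_id
    obtain ⟨x, hxK, hx⟩ := Set.Infinite.exists_accPt_of_subset_isCompact hinf hK (Set.sep_subset _ _)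
    have hfx : f^[n] x = x :=
      isClosed_iff_accPt.1 hcl x (hx.mono (Filter.principal_mono.2 fun y hy => hy.2))
    have hxP : x ∈ periodicPtsOfPeriodLE f K m :=
      ⟨hxK, ⟨n, hn.1, hfx⟩, (Function.IsPeriodicPt.minimalPeriod_le hn.1 hfx).trans hn.2⟩
    have hev := (hyp x hxP).eventually_iterate_ne hf hn.1 hfx
    rw [accPt_iff_frequently_nhdsNE] at hx
    obtain ⟨y, hy1, hy2⟩ := (hx.and_eventually hev).exists
    exact hy2 hy1.2
  refine ((Set.finite_Icc 1 m).biUnion key).subset ?_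
  rintro x ⟨hxK, hxp, hxm⟩
  simp only [Set.mem_iUnion]
  exact ⟨Function.minimalPeriod f x, ⟨Function.minimalPeriod_pos_of_mem_periodicPts hxp, hxm⟩, hxK,
    Function.iterate_minimalPeriod⟩

/-! ### Grid hyperplanes in general position -/

/-- The chart of `M` preferred at `p`, read in `Fin d → ℝ`, whose closed balls are the cubes. -/
noncomputable def cubeChart (d : ℕ) {M : Type*} [TopologicalSpace M]
    [ChartedSpace (EuclideanSpace ℝ (Fin d)) M] (p : M) : OpenPartialHomeomorph M (Fin d → ℝ) :=
  (chartAt (EuclideanSpace ℝ (Fin d)) p).transHomeomorph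
    (EuclideanSpace.equiv (Fin d) ℝ).toHomeomorph

/-- The points of the domain of the chart `h` of which some coordinate differs from the
corresponding coordinate of `c` by a rational number. The faces of all rational cubes centred at
rational translates of `c` lie in it. -/
def gridHyperplanes {d : ℕ} {M : Type*} [TopologicalSpace M]
    (h : OpenPartialHomeomorph M (Fin d → ℝ)) (c : Fin d → ℝ) : Set M :=
  {y | y ∈ h.source ∧ ∃ j, ∃ q : ℚ, h y j = c j + q}

theorem mem_cubeChart_source {d : ℕ} {M : Type*} [TopologicalSpace M]
    [ChartedSpace (EuclideanSpace ℝ (Fin d)) M] (p : M) : p ∈ (cubeChart d p).source :=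
  mem_chart_source (EuclideanSpace ℝ (Fin d)) p

open MeasureTheory in
theorem volume_image_eq_zero_of_contDiffOn {d : ℕ}
    {S : Set (EuclideanSpace ℝ (Fin d))} (hS : IsOpen S)
    {F : EuclideanSpace ℝ (Fin d) → Fin (d + 1) → ℝ} (hF : ContDiffOn ℝ 1 F S) :
    volume (F '' S) = 0 := by
  have h1 : dimH (F '' S) ≤ dimH S := by
    apply dimH_image_le_of_locally_lipschitzOn
    intro x hx
    obtain ⟨C, t, ht, hl⟩ := (hF.contDiffAt (hS.mem_nhds hx)).exists_lipschitzOnWith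
    exact ⟨C, t, mem_nhdsWithin_of_mem_nhds ht, hl⟩
  have h2 : dimH S ≤ d := by
    refine (dimH_mono (Set.subset_univ S)).trans ?_
    rw [Real.dimH_univ_eq_finrank]; simp
  have h3 : dimH (F '' S) < ((d + 1 : ℕ) : NNReal) := by
    refine (h1.trans h2).trans_lt ?_
    norm_cast
    exact Nat.lt_succ_self d
  have := hausdorffMeasure_of_dimH_lt h3
  rw [← hausdorffMeasure_pi_real]
  simpa using this

open MeasureTheory in
/-- The simultaneous values of `d + 1` chart coordinates at points moved by `C¹` maps form a null
set, because the manifold has dimension `d`. -/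
theorem volume_range_chart_coordinates_eq_zero {d : ℕ} {M : Type*} [TopologicalSpace M]
    [CompactSpace M] [ChartedSpace (EuclideanSpace ℝ (Fin d)) M] [IsManifold (𝓡 d) 1 M]
    (F : Fin (d + 1) → M → M) (hF : ∀ r, ContMDiff (𝓡 d) (𝓡 d) 1 (F r))
    (p : Fin (d + 1) → M) (j : Fin (d + 1) → Fin d) :
    volume ((fun x r => cubeChart d (p r) (F r x) (j r)) ''
      {x | ∀ r, F r x ∈ (cubeChart d (p r)).source}) = 0 := by
  set Φ : M → Fin (d + 1) → ℝ := fun x r => cubeChart d (p r) (F r x) (j r) with hΦ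
  set Ω : Set M := {x | ∀ r, F r x ∈ (cubeChart d (p r)).source} with hΩ
  have hΩo : IsOpen Ω := by
    have : Ω = ⋂ r, F r ⁻¹' (cubeChart d (p r)).source := by ext; simp [hΩ]
    rw [this]
    exact isOpen_iInter_of_finite fun r =>
      (cubeChart d (p r)).open_source.preimage (hF r).continuous
  obtain ⟨t, -, ht⟩ := isCompact_univ.elim_nhds_subcover
    (fun x : M => (chartAt (EuclideanSpace ℝ (Fin d)) x).source)
    (fun x _ => chart_source_mem_nhds _ x)
  have hsub : Φ '' Ω ⊆ ⋃ b ∈ t, (fun y => Φ ((chartAt (EuclideanSpace ℝ (Fin d)) b).symm y)) ''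
      ((chartAt (EuclideanSpace ℝ (Fin d)) b).target ∩
        (chartAt (EuclideanSpace ℝ (Fin d)) b).symm ⁻¹' Ω) := by
    rintro _ ⟨x, hx, rfl⟩
    obtain ⟨b, hb, hxb⟩ := Set.mem_iUnion₂.1 (ht (Set.mem_univ x))
    refine Set.mem_iUnion₂.2 ⟨b, hb, (chartAt (EuclideanSpace ℝ (Fin d)) b) x, ⟨?_, ?_⟩, ?_⟩
    · exact OpenPartialHomeomorph.map_source _ hxb
    · simpa [OpenPartialHomeomorph.left_inv _ hxb] using hx
    · simp [OpenPartialHomeomorph.left_inv _ hxb]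
  refine measure_mono_null hsub ((measure_biUnion_null_iff t.countable_toSet).2 fun b _ => ?_)
  set e := chartAt (EuclideanSpace ℝ (Fin d)) b with he
  have hop : IsOpen (e.target ∩ e.symm ⁻¹' Ω) := e.symm.isOpen_inter_preimage hΩo
  refine volume_image_eq_zero_of_contDiffOn hop ?_
  rw [contDiffOn_pi]
  intro r
  have h1 : ContMDiffOn (𝓡 d) (𝓡 d) 1 e.symm (e.target ∩ e.symm ⁻¹' Ω) :=
    contMDiffOn_chart_symm.mono Set.inter_subset_left
  have h2 : ContMDiffOn (𝓡 d) (𝓡 d) 1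
      (fun y => chartAt (EuclideanSpace ℝ (Fin d)) (p r) (F r (e.symm y)))
      (e.target ∩ e.symm ⁻¹' Ω) :=
    (contMDiffOn_chart (x := p r)).comp ((hF r).comp_contMDiffOn h1) (fun y hy => hy.2 r)
  have h3 := h2.contDiffOn
  have h4 : ContDiff ℝ 1 (fun v : EuclideanSpace ℝ (Fin d) => v (j r)) :=
    (EuclideanSpace.proj (𝕜 := ℝ) (j r)).contDiff
  exact h4.comp_contDiffOn h3

open MeasureTheory in
/-- **General position.** The centres of finitely many grids can be moved by arbitrarily little so
that no orbit meets the hyperplanes of more than `d` of the grids. -/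
theorem exists_generic_centers {d : ℕ} {M : Type*} [TopologicalSpace M]
    [CompactSpace M] [ChartedSpace (EuclideanSpace ℝ (Fin d)) M] [IsManifold (𝓡 d) 1 M]
    (F : ℤ → M → M) (hF : ∀ i, ContMDiff (𝓡 d) (𝓡 d) 1 (F i)) {ι : Type*} [Finite ι]
    (p : ι → M) (ρ : ι → ℝ) (hρ : ∀ k, 0 < ρ k) :
    ∃ c : ι → Fin d → ℝ, (∀ k j, |c k j - cubeChart d (p k) (p k) j| < ρ k) ∧
      ∀ x, {k | ∃ i, F i x ∈ gridHyperplanes (cubeChart d (p k)) (c k)}.ncard ≤ d := by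
  have := Fintype.ofFinite ι
  have hae : ∀ a : (Fin (d + 1) ↪ ι) × (Fin (d + 1) → ℤ) × (Fin (d + 1) → Fin d) ×
      (Fin (d + 1) → ℚ), ∀ᵐ c : ι × Fin d → ℝ, (fun r => c (a.1 r, a.2.2.1 r) + a.2.2.2 r) ∉
      (fun x r => cubeChart d (p (a.1 r)) (F (a.2.1 r) x) (a.2.2.1 r)) ''
      {x | ∀ r, F (a.2.1 r) x ∈ (cubeChart d (p (a.1 r))).source} := by
    rintro ⟨k, i, j, q⟩
    simp only
    set Z := (fun x r => cubeChart d (p (k r)) (F (i r) x) (j r)) ''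
      {x | ∀ r, F (i r) x ∈ (cubeChart d (p (k r))).source} with hZ
    have hZ0 : volume Z = 0 :=
      volume_range_chart_coordinates_eq_zero (fun r => F (i r)) (fun r => hF _) (fun r => p (k r)) j
    let L : (ι × Fin d → ℝ) →ₗ[ℝ] (Fin (d + 1) → ℝ) :=
      LinearMap.pi fun r => LinearMap.proj (k r, j r)
    have hL : Function.Surjective L := by
      intro v
      have hinj : Function.Injective (fun r => (k r, j r)) := fun r s h =>
        k.injective (congrArg Prod.fst h)
      refine ⟨Function.extend (fun r => (k r, j r)) v 0, ?_⟩
      ext r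
      exact hinj.extend_apply v 0 r
    have hmeas : MeasurableSet (toMeasurable volume Z)ᶜ := (measurableSet_toMeasurable _ _).compl
    have h0 : ∀ᵐ y : Fin (d + 1) → ℝ, y + (fun r => (q r : ℝ)) ∈ (toMeasurable volume Z)ᶜ := by
      have : volume ((fun y => y + (fun r => (q r : ℝ))) ⁻¹' (toMeasurable volume Z)) = 0 := by
        rw [measure_preimage_add_right, measure_toMeasurable, hZ0]
      rw [ae_iff]
      simp only [Set.mem_compl_iff, not_not]
      exact this
    have hmeas' : MeasurableSet ((fun y : Fin (d + 1) → ℝ => y + (fun r => (q r : ℝ))) ⁻¹'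
        (toMeasurable volume Z)ᶜ) := hmeas.preimage (measurable_add_const _)
    have := (ae_comp_linearMap_mem_iff L (volume : Measure (ι × Fin d → ℝ))
      (volume : Measure (Fin (d + 1) → ℝ)) hL hmeas').2 h0
    filter_upwards [this] with c hc hcZ
    exact hc (subset_toMeasurable _ _ hcZ)
  have hall := ae_all_iff.2 hae
  have hdense := Measure.dense_of_ae hall
  have hopen : IsOpen (Set.univ.pi fun kj : ι × Fin d =>
      Metric.ball (cubeChart d (p kj.1) (p kj.1) kj.2) (ρ kj.1)) :=
    isOpen_set_pi Set.finite_univ fun _ _ => Metric.isOpen_ball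
  obtain ⟨c, hc, hgood⟩ := hdense.exists_mem_open hopen
    ⟨fun kj => cubeChart d (p kj.1) (p kj.1) kj.2, fun kj _ => Metric.mem_ball_self (hρ _)⟩
  refine ⟨fun k j => c (k, j), fun k j => ?_, fun x => ?_⟩
  · have := hgood (k, j) trivial
    rwa [Metric.mem_ball, Real.dist_eq] at this
  by_contra hcard
  push Not at hcard
  set T := {k | ∃ i, F i x ∈ gridHyperplanes (cubeChart d (p k)) (fun j => c (k, j))} with hT
  obtain ⟨s, hsT, hs⟩ := Set.exists_subset_card_eq (s := T) (n := d + 1) hcard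
  obtain ⟨k, hk⟩ : ∃ k : Fin (d + 1) ↪ ι, ∀ r, k r ∈ T := by
    have hcard' : Nat.card s = d + 1 := by rw [Nat.card_coe_set_eq, hs]
    let e := (Finite.equivFinOfCardEq hcard').symm
    exact ⟨e.toEmbedding.trans (Function.Embedding.subtype _), fun r => hsT (e r).2⟩
  choose i hi using hk
  choose hsrc j q hq using hi
  refine hc ⟨k, i, j, q⟩ ⟨x, hsrc, ?_⟩
  ext r
  exact hq r

/-! ### Extending the base of a tower -/

/-- The iterates of `A` at nonzero times of absolute value at most `n` are disjoint from `A`. -/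
def SeparatedIterates {M : Type*} [TopologicalSpace M] (φ : M ≃ₜ M) (n : ℕ) (A : Set M) : Prop :=
  ∀ u : ℤ, u ≠ 0 → |u| ≤ n → ∀ x ∈ A, (φ ^ u) x ∉ A

/-- `A` is covered by the interiors of arbitrarily fine finite families of closed subsets (cells)
of `E`, coloured with `C` colours so that distinct cells of the same colour are disjoint, and whose
boundaries lie in `B`. Fineness is expressed by subordination to any assignment of
neighbourhoods. -/
def HasFineColoredCovers {M : Type*} [TopologicalSpace M] (C : ℕ) (A B E : Set M) : Prop :=
  ∀ O : M → Set M, (∀ x ∈ E, O x ∈ nhds x) →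
    ∃ (Z : Type) (_ : Finite Z) (D : Z → Set M) (χ : Z → Fin C),
      (∀ z, IsClosed (D z)) ∧ A ⊆ ⋃ z, interior (D z) ∧ (∀ z, D z ⊆ E) ∧
      (∀ z, D z \ interior (D z) ⊆ B) ∧
      (∀ z w, χ z = χ w → z ≠ w → Disjoint (D z) (D w)) ∧ ∀ z, ∃ x ∈ E, D z ⊆ O x

/-- The state of the construction: a closed set `W` with separated iterates and small connected
subsets, whose frontier inside `K` is distributed over label sets `F k a` so that a point labelled
`(k, a)` has its orbit through `B k` and the orbit segments of length `L + 2 N` meet each label set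
at most once. -/
structure IsTowerBase {M ι : Type*} [EMetricSpace M] (φ : M ≃ₜ M) (K : Set M) (N C L : ℕ)
    (ε : ENNReal) (B : ι → Set M) (W : Set M) (F : ι → Option (Fin C) → Set M) : Prop where
  isClosed : IsClosed W
  separated : SeparatedIterates φ N W
  ediam_le : ∀ S ⊆ W, IsPreconnected S → Metric.ediam S ≤ ε
  exists_label : ∀ x ∈ K, x ∈ W → x ∉ interior W → ∃ k a, x ∈ F k a
  label_orbit : ∀ k a, ∀ x ∈ F k a, ∃ i : ℤ, (φ ^ i) x ∈ B k
  label_separated : ∀ k a, SeparatedIterates φ (L + 2 * N) (F k a)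

theorem homeomorph_zpow_add_apply {M : Type*} [TopologicalSpace M] (φ : M ≃ₜ M) (i j : ℤ) (x : M) :
    (φ ^ (i + j)) x = (φ ^ i) ((φ ^ j) x) := by
  rw [zpow_add]; rfl

theorem homeomorph_zpow_sub_apply_eq {M : Type*} [TopologicalSpace M] (φ : M ≃ₜ M) {i j : ℤ}
    {x y : M} (h : (φ ^ i) x = (φ ^ j) y) : (φ ^ (i - j)) x = y := by
  rw [show i - j = -j + i by ring, homeomorph_zpow_add_apply, h, ← homeomorph_zpow_add_apply]
  simp

theorem SeparatedIterates.mono {M : Type*} [TopologicalSpace M] {φ : M ≃ₜ M} {m n : ℕ}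
    {A E : Set M} (h : SeparatedIterates φ n E) (hmn : m ≤ n) (hA : A ⊆ E) :
    SeparatedIterates φ m A :=
  fun u hu hum x hx hx' =>
    h u hu (hum.trans (by exact_mod_cast hmn)) x (hA hx) (hA hx')

theorem IsPreconnected.subset_of_isClosed_disjoint {M : Type*} [TopologicalSpace M]
    {S A B : Set M} (hS : IsPreconnected S) (hA : IsClosed A) (hB : IsClosed B)
    (hAB : Disjoint A B) (hSAB : S ⊆ A ∪ B) (hne : (S ∩ A).Nonempty) : S ⊆ A := by
  rcases isPreconnected_iff_subset_of_disjoint_closed.1 hS A B hA hB hSAB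
    (by rw [hAB.inter_eq, Set.inter_empty]) with h | h
  · exact h
  · obtain ⟨x, hx, hxA⟩ := hne
    exact absurd (h hx) (Set.disjoint_left.1 hAB hxA)

/-- Along an orbit segment that avoids the interior of the base, the base is met at most
`d * (C + 1)` times. -/
theorem IsTowerBase.ncard_hits_le {M ι : Type*} [EMetricSpace M] [Finite ι] {φ : M ≃ₜ M}
    {K : Set M} {N C L d : ℕ} {ε : ENNReal} {B : ι → Set M} {W : Set M}
    {F : ι → Option (Fin C) → Set M} (h : IsTowerBase φ K N C L ε B W F)
    (hK : ∀ i : ℤ, ∀ x ∈ K, (φ ^ i) x ∈ K)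
    (hB : ∀ x, {k | ∃ i : ℤ, (φ ^ i) x ∈ B k}.ncard ≤ d) {x : M} (hx : x ∈ K)
    (hint : ∀ t : ℤ, -N ≤ t → t ≤ L + N → (φ ^ t) x ∉ interior W) :
    {t : ℤ | -N ≤ t ∧ t ≤ L + N ∧ (φ ^ t) x ∈ W}.ncard ≤ d * (C + 1) := by
  set T := {t : ℤ | -N ≤ t ∧ t ≤ L + N ∧ (φ ^ t) x ∈ W} with hT
  have hlab : ∀ t ∈ T, ∃ ka : ι × Option (Fin C), (φ ^ t) x ∈ F ka.1 ka.2 := by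
    intro t ht
    obtain ⟨k, a, hka⟩ := h.exists_label _ (hK t x hx) ht.2.2 (hint t ht.1 ht.2.1)
    exact ⟨(k, a), hka⟩
  rcases T.eq_empty_or_nonempty with hT0 | ⟨t₀, ht₀⟩
  · simp [hT0]
  have : Nonempty (ι × Option (Fin C)) := ⟨(hlab t₀ ht₀).choose⟩
  choose! g hg using hlab
  have hmaps : ∀ t ∈ T, g t ∈ {k | ∃ i : ℤ, (φ ^ i) x ∈ B k} ×ˢ (Set.univ : Set (Option (Fin C))) := by
    intro t ht
    refine ⟨?_, trivial⟩
    obtain ⟨i, hi⟩ := h.label_orbit _ _ _ (hg t ht)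
    exact ⟨i + t, by rwa [homeomorph_zpow_add_apply]⟩
  have hinj : Set.InjOn g T := by
    intro s hs t ht hst
    by_contra hne
    refine h.label_separated (g s).1 (g s).2 (t - s) (by omega) ?_ _ (hg s hs) ?_
    · have h1 := hs.1; have h2 := hs.2.1; have h3 := ht.1; have h4 := ht.2.1
      rw [abs_le]; push_cast; constructor <;> linarith
    · rw [← homeomorph_zpow_add_apply, sub_add_cancel, hst]
      exact hg t ht
  refine (Set.ncard_le_ncard_of_injOn g hmaps hinj (Set.toFinite _)).trans ?_
  rw [Set.ncard_prod, Set.ncard_univ]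
  simpa using Nat.mul_le_mul_right (C + 1) (hB x)

/-- At most `H` times can obstruct at most `H * (2 * N + 1)` neighbouring slots. -/
theorem exists_int_far_from {T : Set ℤ} (hT : T.Finite) {H N : ℕ} (hH : T.ncard ≤ H) (a : ℤ) :
    ∃ i : ℤ, a ≤ i ∧ i ≤ a + H * (2 * N + 1) ∧ ∀ t ∈ T, (N : ℤ) < |i - t| := by
  classical
  have hlt : (hT.toFinset.biUnion fun t => Finset.Icc (t - N) (t + N)).card
      < (Finset.Icc a (a + H * (2 * N + 1))).card := by
    have h1 : (hT.toFinset.biUnion fun t => Finset.Icc (t - N) (t + N)).card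
        ≤ hT.toFinset.card * (2 * N + 1) := by
      apply Finset.card_biUnion_le_card_mul
      intro t _
      simp only [Int.card_Icc]
      omega
    rw [← Set.ncard_eq_toFinset_card T hT] at h1
    have h2 : T.ncard * (2 * N + 1) ≤ H * (2 * N + 1) := Nat.mul_le_mul_right _ hH
    have h3 : (Finset.Icc a (a + H * (2 * N + 1))).card = H * (2 * N + 1) + 1 := by
      rw [Int.card_Icc]
      have : (a + H * (2 * N + 1) + 1 - a : ℤ) = ((H * (2 * N + 1) + 1 : ℕ) : ℤ) := by
        push_cast; ring
      rw [this, Int.toNat_natCast]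
    omega
  obtain ⟨i, hi, hi'⟩ := Finset.exists_mem_notMem_of_card_lt_card hlt
  rw [Finset.mem_Icc] at hi
  refine ⟨i, hi.1, hi.2, fun t ht => ?_⟩
  by_contra hcon
  apply hi'
  rw [not_lt, abs_le] at hcon
  simp only [Finset.mem_biUnion, Set.Finite.mem_toFinset, Finset.mem_Icc]
  exact ⟨t, ht, by omega, by omega⟩

/-- **Extension step.** The base is enlarged so that every orbit of `K` starting in `A` meets its
interior. The set `A` is cut into cells so fine that each one either is carried into the interior
of the base, or has, for every colour `χ`, an iterate far from the base during the whole time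
window of that colour. Cells of the second kind are added to the base at such a time: different
colours use distant windows, and cells of the same colour are disjoint. -/
theorem IsTowerBase.exists_extension {M ι : Type*} [EMetricSpace M] [Finite ι] {φ : M ≃ₜ M}
    {K : Set M} (hKc : IsClosed K) {N C L d : ℕ} {ε : ENNReal} {B : ι → Set M} {W : Set M}
    {F : ι → Option (Fin C) → Set M} (h : IsTowerBase φ K N C L ε B W F)
    (hL : L = C * (d * (C + 1) * (2 * N + 1) + N + 1))
    (hK : ∀ i : ℤ, ∀ x ∈ K, (φ ^ i) x ∈ K)
    (hB : ∀ x, {k | ∃ i : ℤ, (φ ^ i) x ∈ B k}.ncard ≤ d)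
    {k : ι} {A E : Set M} (hcov : HasFineColoredCovers C A (B k) E)
    (hE : SeparatedIterates φ (2 * (L + N)) E)
    (hEε : ∀ i : ℤ, 0 ≤ i → i ≤ L → Metric.ediam ((φ ^ i) '' E) ≤ ε)
    (hFk : ∀ c, F k (some c) = ∅) :
    ∃ (W' : Set M) (F' : ι → Option (Fin C) → Set M), IsTowerBase φ K N C L ε B W' F' ∧
      W ⊆ W' ∧ (∀ k' ≠ k, F' k' = F k') ∧
      ∀ x ∈ A, x ∈ K → ∃ i : ℤ, -N ≤ i ∧ i ≤ L + N ∧ (φ ^ i) x ∈ interior W' := by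
  classical
  set b := d * (C + 1) * (2 * N + 1) with hb
  set covered : Set M := {x | ∃ i : ℤ, -N ≤ i ∧ i ≤ L + N ∧ (φ ^ i) x ∈ interior W} with hcovd
  have hcovo : IsOpen covered := by
    have : covered = ⋃ i ∈ {i : ℤ | -N ≤ i ∧ i ≤ L + N}, (φ ^ i) ⁻¹' interior W := by
      ext x; simp [hcovd, and_assoc]
    rw [this]
    exact isOpen_biUnion fun i _ => isOpen_interior.preimage (φ ^ i).continuous
  have hslot : ∀ x, x ∈ K ∧ x ∉ covered → ∀ c : Fin C, ∃ i : ℤ,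
      (c : ℕ) * (b + N + 1) ≤ i ∧ i ≤ (c : ℕ) * (b + N + 1) + b ∧
        ∀ u : ℤ, |u| ≤ N → (φ ^ (i + u)) x ∉ W := by
    rintro x ⟨hxK, hxc⟩ c
    have hhit := h.ncard_hits_le hK hB hxK (fun t h1 h2 h3 => hxc ⟨t, h1, h2, h3⟩)
    have hfin : {t : ℤ | -N ≤ t ∧ t ≤ L + N ∧ (φ ^ t) x ∈ W}.Finite :=
      (Set.finite_Icc (-N : ℤ) (L + N)).subset fun t ht => ⟨ht.1, ht.2.1⟩
    have hbZ : ((d * (C + 1) : ℕ) * (2 * N + 1) : ℤ) = b := by rw [hb]; push_cast; ring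
    obtain ⟨i, hi1, hi2, hi3⟩ := exists_int_far_from (N := N) hfin hhit ((c : ℕ) * (b + N + 1))
    rw [hbZ] at hi2
    refine ⟨i, hi1, hi2, fun u hu hW => ?_⟩
    have hc : ((c : ℕ) : ℤ) + 1 ≤ C := by exact_mod_cast c.2
    have hi0 : 0 ≤ i := le_trans (by positivity) hi1
    have hiL : i ≤ L := by
      have : (((c : ℕ) : ℤ) + 1) * (b + N + 1) ≤ C * (b + N + 1) :=
        mul_le_mul_of_nonneg_right hc (by positivity)
      rw [hL]; push_cast; linarith
    rw [abs_le] at hu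
    have := hi3 (i + u) ⟨by linarith, by linarith, hW⟩
    rw [show i - (i + u) = -u by ring, abs_neg] at this
    exact absurd (abs_le.2 hu) (not_le.2 this)
  choose! slot hslot1 hslot2 hslot3 using hslot
  let O : M → Set M := fun x => if x ∈ K then (if x ∈ covered then covered else
    ⋂ c : Fin C, ⋂ u ∈ Set.Icc (-N : ℤ) N, (φ ^ (slot x c + u)) ⁻¹' Wᶜ) else Kᶜ
  have hO : ∀ x ∈ E, O x ∈ nhds x := by
    intro x _
    by_cases hxK : x ∈ K
    · by_cases hxc : x ∈ covered
      · simp only [O, if_pos hxK, if_pos hxc]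
        exact hcovo.mem_nhds hxc
      · simp only [O, if_pos hxK, if_neg hxc]
        refine IsOpen.mem_nhds ?_ ?_
        · refine isOpen_iInter_of_finite fun c => (Set.finite_Icc _ _).isOpen_biInter fun u _ => ?_
          exact h.isClosed.isOpen_compl.preimage (φ ^ _).continuous
        · simp only [Set.mem_iInter]
          exact fun c u hu => hslot3 x ⟨hxK, hxc⟩ c u (abs_le.2 hu)
    · simp only [O, if_neg hxK]
      exact hKc.isOpen_compl.mem_nhds hxK
  obtain ⟨Z, hZ, D, χ, hDc, hAD, hDE, hDB, hDχ, hDO⟩ := hcov O hO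
  choose base hbaseE hbase using hDO
  let Good : Set Z := {z | base z ∈ K ∧ base z ∉ covered}
  let τ : Z → ℤ := fun z => slot (base z) (χ z)
  have hτ0 : ∀ z ∈ Good, 0 ≤ τ z := fun z hz => le_trans (by positivity) (hslot1 _ hz (χ z))
  have hτL : ∀ z ∈ Good, τ z ≤ L := by
    intro z hz
    refine (hslot2 _ hz (χ z)).trans ?_
    have hc : ((χ z : ℕ) : ℤ) + 1 ≤ C := by exact_mod_cast (χ z).2
    have : (((χ z : ℕ) : ℤ) + 1) * (b + N + 1) ≤ C * (b + N + 1) :=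
        mul_le_mul_of_nonneg_right hc (by positivity)
    rw [hL]; push_cast; linarith
  -- Two added cells can meet within time `N` only if they coincide.
  have hmeet : ∀ z ∈ Good, ∀ w ∈ Good, ∀ u : ℤ, |u| ≤ N → ∀ x ∈ D z, ∀ y ∈ D w,
      (φ ^ (τ z + u)) x = (φ ^ τ w) y → z = w ∧ u = 0 := by
    intro z hz w hw u hu x hx y hy hxy
    have hu' := abs_le.1 hu
    have hyx := homeomorph_zpow_sub_apply_eq φ hxy
    have ht : τ z + u - τ w = 0 := by
      by_contra hne
      refine hE _ hne ?_ x (hDE z hx) (hyx ▸ hDE w hy)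
      have := hτ0 z hz; have := hτL z hz; have := hτ0 w hw; have := hτL w hw
      rw [abs_le]; push_cast; constructor <;> linarith
    rw [ht, zpow_zero, Homeomorph.one_apply] at hyx
    subst hyx
    by_cases hc : χ z = χ w
    · have hzw : z = w := by
        by_contra hne
        exact Set.disjoint_left.1 (hDχ z w hc hne) hx hy
      subst hzw
      exact ⟨rfl, by linarith⟩
    · exfalso
      have h1 := hslot1 _ hz (χ z); have h2 := hslot2 _ hz (χ z)
      have h3 := hslot1 _ hw (χ w); have h4 := hslot2 _ hw (χ w)
      change _ ≤ τ z at h1; change τ z ≤ _ at h2; change _ ≤ τ w at h3; change τ w ≤ _ at h4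
      rcases Nat.lt_or_gt_of_ne (fun h' => hc (Fin.ext h')) with hlt | hlt
      · have h5 : (((χ z : ℕ) : ℤ) + 1) * (b + N + 1) ≤ ((χ w : ℕ) : ℤ) * (b + N + 1) :=
          mul_le_mul_of_nonneg_right (by exact_mod_cast hlt) (by positivity)
        linarith
      · have h5 : (((χ w : ℕ) : ℤ) + 1) * (b + N + 1) ≤ ((χ z : ℕ) : ℤ) * (b + N + 1) :=
          mul_le_mul_of_nonneg_right (by exact_mod_cast hlt) (by positivity)
        linarith
  have havoid : ∀ z ∈ Good, ∀ u : ℤ, |u| ≤ N → ∀ x ∈ D z, (φ ^ (τ z + u)) x ∉ W := by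
    intro z hz u hu x hx
    have := hbase z hx
    simp only [O, if_pos hz.1, if_neg hz.2, Set.mem_iInter] at this
    exact this (χ z) u (abs_le.1 hu)
  let P : Z → Set M := fun z => (φ ^ τ z) '' D z
  have hPc : ∀ z, IsClosed (P z) := fun z => (φ ^ τ z).isClosedMap _ (hDc z)
  have hPW : ∀ z ∈ Good, Disjoint (P z) W := by
    intro z hz
    rw [Set.disjoint_left]
    rintro _ ⟨x, hx, rfl⟩
    simpa using havoid z hz 0 (by simp) x hx
  have hPP : ∀ z ∈ Good, ∀ w ∈ Good, z ≠ w → Disjoint (P z) (P w) := by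
    intro z hz w hw hzw
    rw [Set.disjoint_left]
    rintro _ ⟨x, hx, rfl⟩ ⟨y, hy, hxy⟩
    exact hzw (hmeet z hz w hw 0 (by simp) x hx y hy (by simpa using hxy.symm)).1
  set W' := W ∪ ⋃ z ∈ Good, P z with hW'
  set F' : ι → Option (Fin C) → Set M := fun k' a => if k' = k then
    (match a with
      | none => F k none
      | some c => ⋃ z ∈ {z | z ∈ Good ∧ χ z = c}, (φ ^ τ z) '' (D z \ interior (D z)))
    else F k' a with hF'
  have hPsub : ∀ z ∈ Good, P z ⊆ W' := fun z hz =>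
    (Set.subset_biUnion_of_mem (u := P) hz).trans Set.subset_union_right
  refine ⟨W', F', ⟨?_, ?_, ?_, ?_, ?_, ?_⟩, Set.subset_union_left, ?_, ?_⟩
  · exact h.isClosed.union ((Set.toFinite Good).isClosed_biUnion fun z _ => hPc z)
  · intro u hu huN y hy hy'
    rcases hy with hy | hy <;> rcases hy' with hy' | hy'
    · exact h.separated u hu huN y hy hy'
    · obtain ⟨z, hz, x, hx, hxy⟩ := Set.mem_iUnion₂.1 hy'
      refine havoid z hz (-u) (by rwa [abs_neg]) x hx ?_
      rw [show τ z + -u = -u + τ z by ring, homeomorph_zpow_add_apply, hxy,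
        ← homeomorph_zpow_add_apply]
      simpa using hy
    · obtain ⟨z, hz, x, hx, rfl⟩ := Set.mem_iUnion₂.1 hy
      rw [← homeomorph_zpow_add_apply, add_comm] at hy'
      exact havoid z hz u huN x hx hy'
    · obtain ⟨z, hz, x, hx, rfl⟩ := Set.mem_iUnion₂.1 hy
      obtain ⟨w, hw, x', hx', hxx⟩ := Set.mem_iUnion₂.1 hy'
      rw [← homeomorph_zpow_add_apply, add_comm] at hxx
      exact hu (hmeet z hz w hw u huN x hx x' hx' hxx.symm).2
  · intro S hS hSp
    by_cases hne : ∃ z ∈ Good, (S ∩ P z).Nonempty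
    · obtain ⟨z, hz, hzS⟩ := hne
      have hsub : S ⊆ P z := by
        refine hSp.subset_of_isClosed_disjoint (hPc z)
          (B := W ∪ ⋃ w ∈ {w | w ∈ Good ∧ w ≠ z}, P w)
          (h.isClosed.union ((Set.toFinite _).isClosed_biUnion fun w _ => hPc w)) ?_ ?_ hzS
        · rw [Set.disjoint_union_right]
          refine ⟨hPW z hz, ?_⟩
          simp only [Set.disjoint_iUnion_right]
          exact fun w hw => hPP z hz w hw.1 hw.2.symm
        · intro x hx
          rcases hS hx with hxW | hxP
          · exact Or.inr (Or.inl hxW)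
          · obtain ⟨w, hw, hxw⟩ := Set.mem_iUnion₂.1 hxP
            by_cases hwz : w = z
            · exact Or.inl (hwz ▸ hxw)
            · exact Or.inr (Or.inr (Set.mem_iUnion₂.2 ⟨w, ⟨hw, hwz⟩, hxw⟩))
      refine (Metric.ediam_mono (hsub.trans (Set.image_mono (hDE z)))).trans ?_
      exact hEε _ (hτ0 z hz) (hτL z hz)
    · refine h.ediam_le S (fun x hx => ?_) hSp
      rcases hS hx with hxW | hxP
      · exact hxW
      · obtain ⟨w, hw, hxw⟩ := Set.mem_iUnion₂.1 hxP
        exact absurd ⟨w, hw, x, hx, hxw⟩ hne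
  · intro x hxK hx hxi
    rcases hx with hx | hx
    · obtain ⟨k', a, hk'⟩ := h.exists_label x hxK hx
        (fun h' => hxi (interior_mono Set.subset_union_left h'))
      refine ⟨k', a, ?_⟩
      by_cases hkk : k' = k
      · subst hkk
        cases a with
        | none => simpa [hF'] using hk'
        | some c => rw [hFk c] at hk'; exact hk'.elim
      · simpa [hF', hkk] using hk'
    · obtain ⟨z, hz, y, hy, rfl⟩ := Set.mem_iUnion₂.1 hx
      refine ⟨k, some (χ z), ?_⟩
      simp only [hF', if_true]
      refine Set.mem_iUnion₂.2 ⟨z, ⟨hz, rfl⟩, y, ⟨hy, fun hyi => hxi ?_⟩, rfl⟩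
      refine interior_mono (hPsub z hz) ?_
      rw [← Homeomorph.image_interior]
      exact ⟨y, hyi, rfl⟩
  · intro k' a x hx
    by_cases hkk : k' = k
    · subst hkk
      cases a with
      | none => exact h.label_orbit k' none x (by simpa [hF'] using hx)
      | some c =>
        simp only [hF', if_true] at hx
        obtain ⟨z, hz, y, hy, rfl⟩ := Set.mem_iUnion₂.1 hx
        refine ⟨-τ z, ?_⟩
        rw [← homeomorph_zpow_add_apply]
        simpa using hDB z hy
    · exact h.label_orbit k' a x (by simpa [hF', hkk] using hx)
  · intro k' a
    by_cases hkk : k' = k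
    · subst hkk
      cases a with
      | none => simpa [hF'] using h.label_separated k' none
      | some c =>
        intro u hu huL x hx hx'
        simp only [hF', if_true] at hx hx'
        obtain ⟨z, ⟨hz, hzc⟩, y, hy, rfl⟩ := Set.mem_iUnion₂.1 hx
        obtain ⟨w, ⟨hw, hwc⟩, y', hy', hyy⟩ := Set.mem_iUnion₂.1 hx'
        rw [← homeomorph_zpow_add_apply] at hyy
        have hyx := homeomorph_zpow_sub_apply_eq φ hyy.symm
        have ht : u + τ z - τ w = 0 := by
          by_contra hne
          refine hE _ hne ?_ y (hDE z hy.1) (hyx ▸ hDE w hy'.1)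
          have := hτ0 z hz; have := hτL z hz; have := hτ0 w hw; have := hτL w hw
          have hu' := abs_le.1 huL
          push_cast at hu'
          rw [abs_le]; push_cast; constructor <;> linarith
        rw [ht, zpow_zero, Homeomorph.one_apply] at hyx
        subst hyx
        have hzw : z = w := by
          by_contra hne
          exact Set.disjoint_left.1 (hDχ z w (hzc.trans hwc.symm) hne) hy.1 hy'.1
        subst hzw
        exact hu (by linarith)
    · simpa [hF', hkk] using h.label_separated k' a
  · intro k' hk'
    ext1 a
    simp [hF', hk']
  · intro x hxA hxK
    obtain ⟨z, hz⟩ := Set.mem_iUnion.1 (hAD hxA)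
    have hxO := hbase z (interior_subset hz)
    by_cases hbK : base z ∈ K
    · by_cases hbc : base z ∈ covered
      · simp only [O, if_pos hbK, if_pos hbc] at hxO
        obtain ⟨i, h1, h2, h3⟩ := hxO
        exact ⟨i, h1, h2, interior_mono Set.subset_union_left h3⟩
      · have hzG : z ∈ Good := ⟨hbK, hbc⟩
        refine ⟨τ z, ?_, ?_, interior_mono (hPsub z hzG) ?_⟩
        · have := hτ0 z hzG; linarith
        · have := hτL z hzG; linarith
        · rw [← Homeomorph.image_interior]
          exact ⟨x, hz, rfl⟩
    · simp only [O, if_neg hbK] at hxO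
      exact absurd hxK hxO

/-! ### Coloured cubical subdivisions of boxes -/

/-- The closed cube of centre `c` and half-side `r` in the chart `h`. -/
def chartBox {d : ℕ} {M : Type*} [TopologicalSpace M] (h : OpenPartialHomeomorph M (Fin d → ℝ))
    (c : Fin d → ℝ) (r : ℝ) : Set M :=
  h.source ∩ h ⁻¹' Metric.closedBall c r

theorem isClosed_chartBox {d : ℕ} {M : Type*} [TopologicalSpace M] [T2Space M]
    (h : OpenPartialHomeomorph M (Fin d → ℝ)) {c : Fin d → ℝ} {r : ℝ}
    (hr : Metric.closedBall c r ⊆ h.target) : IsClosed (chartBox h c r) := by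
  rw [chartBox, ← h.symm_image_eq_source_inter_preimage hr]
  exact ((isCompact_closedBall c r).image_of_continuousOn
    (h.continuousOn_symm.mono hr)).isClosed

theorem subset_interior_chartBox {d : ℕ} {M : Type*} [TopologicalSpace M]
    (h : OpenPartialHomeomorph M (Fin d → ℝ)) (c : Fin d → ℝ) (r : ℝ) :
    h.source ∩ h ⁻¹' Metric.ball c r ⊆ interior (chartBox h c r) :=
  interior_maximal (Set.inter_subset_inter_right _ (Set.preimage_mono Metric.ball_subset_closedBall))
    (h.isOpen_inter_preimage Metric.isOpen_ball)

theorem chartBox_diff_interior_subset {d : ℕ} {M : Type*} [TopologicalSpace M]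
    (h : OpenPartialHomeomorph M (Fin d → ℝ)) {c c' : Fin d → ℝ} {r : ℚ} (hr : 0 < r)
    (hc : ∀ j, ∃ q : ℚ, c' j = c j + q) :
    chartBox h c' r \ interior (chartBox h c' r) ⊆ gridHyperplanes h c := by
  rintro y ⟨⟨hys, hy⟩, hyi⟩
  have hy2 : h y ∉ Metric.ball c' r := fun hb => hyi (subset_interior_chartBox h c' r ⟨hys, hb⟩)
  have hr' : (0 : ℝ) < r := by exact_mod_cast hr
  rw [Metric.mem_ball, dist_pi_lt_iff hr'] at hy2
  rw [Set.mem_preimage, Metric.mem_closedBall, dist_pi_le_iff hr'.le] at hy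
  push Not at hy2
  obtain ⟨j, hj⟩ := hy2
  have hj' : |h y j - c' j| = r := le_antisymm (by simpa [Real.dist_eq] using hy j)
    (by simpa [Real.dist_eq] using hj)
  obtain ⟨q, hq⟩ := hc j
  refine ⟨hys, j, ?_⟩
  rcases (abs_eq hr'.le).1 hj' with h1 | h1
  · exact ⟨q + r, by push_cast; linarith⟩
  · exact ⟨q - r, by push_cast; linarith⟩

/-- A box is covered by the cubes of a regular mesh, enlarged by a half so that their interiors
overlap; the parities of the coordinates of a cube are its colour. -/
theorem hasFineColoredCovers_chartBox {d : ℕ} {M : Type*} [TopologicalSpace M] [T2Space M]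
    (h : OpenPartialHomeomorph M (Fin d → ℝ)) {c : Fin d → ℝ} {r : ℚ} (hr : 0 < r)
    (ht : Metric.closedBall c (2 * r) ⊆ h.target) :
    HasFineColoredCovers (2 ^ d) (chartBox h c r) (gridHyperplanes h c) (chartBox h c (2 * r)) := by
  intro O hO
  have hr' : (0 : ℝ) < r := by exact_mod_cast hr
  have hsymm : ∀ y ∈ Metric.closedBall c (2 * r : ℝ), h.symm y ∈ chartBox h c (2 * r) := by
    intro y hy
    exact ⟨h.map_target (ht hy), by rwa [Set.mem_preimage, h.right_inv (ht hy)]⟩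
  obtain ⟨δ, hδ, hleb⟩ := lebesgue_number_lemma_of_metric (isCompact_closedBall c (2 * r : ℝ))
    (c := fun y : Metric.closedBall c (2 * r : ℝ) => interior (h.symm ⁻¹' O (h.symm y)))
    (fun _ => isOpen_interior) (fun y hy => Set.mem_iUnion.2 ⟨⟨y, hy⟩, by
      rw [mem_interior_iff_mem_nhds]
      exact (h.continuousAt_symm (ht hy)).preimage_mem_nhds (hO _ (hsymm y hy))⟩)
  obtain ⟨m, hm⟩ := exists_nat_gt ((r : ℝ) / δ)
  have hm0 : (0 : ℝ) < m := lt_trans (by positivity) hm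
  have hm1 : (1 : ℝ) ≤ m := by
    have : 0 < m := by exact_mod_cast hm0
    exact_mod_cast this
  set η : ℚ := r / m with hη
  have hηR : ((η : ℚ) : ℝ) = r / m := by rw [hη]; push_cast; rfl
  have hη0 : (0 : ℝ) < η := by rw [hηR]; positivity
  have hη0' : 0 < η := by exact_mod_cast hη0
  have hηm : (η : ℝ) * m = r := by rw [hηR]; field_simp
  have hηr : (η : ℝ) ≤ r := by nlinarith
  have hηδ : (η : ℝ) < δ := by
    rw [div_lt_iff₀ hδ] at hm
    rw [hηR, div_lt_iff₀ hm0]; linarith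
  let center : (Fin d → Fin (2 * m)) → Fin d → ℝ := fun z j => c j - r + ((z j : ℕ) + 1 / 2) * η
  have hcr : ∀ z j, ∃ q : ℚ, center z j = c j + q := fun z j =>
    ⟨-r + ((z j : ℕ) + 1 / 2) * η, by simp only [center]; push_cast; ring⟩
  have hrat : ((3 / 4 * η : ℚ) : ℝ) = 3 / 4 * η := by push_cast; ring
  have hin : ∀ z, Metric.closedBall (center z) (3 / 4 * η : ℚ) ⊆ Metric.closedBall c (2 * r) := by
    intro z y hy
    rw [hrat, Metric.mem_closedBall, dist_pi_le_iff (by positivity)] at hy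
    rw [Metric.mem_closedBall, dist_pi_le_iff (by positivity)]
    intro j
    have hyj := hy j
    rw [Real.dist_eq, abs_le] at hyj ⊢
    have hz1 : ((z j : ℕ) : ℝ) + 1 ≤ 2 * m := by exact_mod_cast (z j).2
    have h1 : (((z j : ℕ) : ℝ) + 1) * η ≤ 2 * m * η := mul_le_mul_of_nonneg_right hz1 hη0.le
    have h2 : 0 ≤ ((z j : ℕ) : ℝ) * η := by positivity
    simp only [center] at hyj
    constructor <;> nlinarith
  let par : Fin d → Fin (2 * m) → Fin 2 := fun _ i => ⟨(i : ℕ) % 2, Nat.mod_lt _ two_pos⟩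
  refine ⟨Fin d → Fin (2 * m), inferInstance, fun z => chartBox h (center z) (3 / 4 * η : ℚ),
    fun z => finFunctionFinEquiv fun j => par j (z j), fun z => ?_, ?_, fun z => ?_, fun z => ?_, ?_,
    fun z => ?_⟩
  · exact isClosed_chartBox h ((hin z).trans ht)
  · rintro y ⟨hys, hy⟩
    rw [Set.mem_preimage, Metric.mem_closedBall, dist_pi_le_iff hr'.le] at hy
    have hex : ∀ j, ∃ i : Fin (2 * m), |h y j - (c j - r + ((i : ℕ) + 1 / 2) * η)| ≤ η / 2 := by
      intro j
      have hyj := hy j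
      rw [Real.dist_eq, abs_le] at hyj
      set s : ℝ := (h y j - c j + r) / η with hs
      have hs0 : 0 ≤ s := div_nonneg (by linarith) hη0.le
      have hsη : s * η = h y j - c j + r := by rw [hs]; field_simp
      have hs2 : s ≤ 2 * m := by
        rw [hs, div_le_iff₀ hη0]; nlinarith
      by_cases hcase : ⌊s⌋₊ < 2 * m
      · refine ⟨⟨⌊s⌋₊, hcase⟩, ?_⟩
        have h1 := Nat.floor_le hs0
        have h2 := Nat.lt_floor_add_one s
        have h3 : (⌊s⌋₊ : ℝ) * η ≤ s * η := mul_le_mul_of_nonneg_right h1 hη0.le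
        have h4 : s * η ≤ ((⌊s⌋₊ : ℝ) + 1) * η := mul_le_mul_of_nonneg_right h2.le hη0.le
        rw [abs_le]
        constructor <;> simp only <;> nlinarith
      · -- The last cube of the row also contains the right end of the box.
        push Not at hcase
        have h1 : (2 * m : ℝ) ≤ s := by
          have := (Nat.le_floor_iff hs0).1 hcase
          exact_mod_cast this
        have hseq : s = 2 * m := le_antisymm hs2 h1
        have hm' : 0 < m := by exact_mod_cast hm0
        refine ⟨⟨2 * m - 1, by omega⟩, ?_⟩
        have hcast : ((2 * m - 1 : ℕ) : ℝ) = 2 * m - 1 := by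
          rw [Nat.cast_sub (by omega)]; push_cast; ring
        rw [hseq] at hsη
        simp only [hcast]
        rw [abs_le]
        constructor <;> nlinarith
    choose z hz using hex
    refine Set.mem_iUnion.2 ⟨z, subset_interior_chartBox h _ _ ⟨hys, ?_⟩⟩
    rw [hrat, Set.mem_preimage, Metric.mem_ball, dist_pi_lt_iff (by positivity)]
    intro j
    rw [Real.dist_eq]
    have := hz j
    simp only [center]
    linarith
  · exact Set.inter_subset_inter_right _ (Set.preimage_mono (hin z))
  · exact chartBox_diff_interior_subset h (by positivity) (hcr z)
  · intro z w hzw hne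
    have hpar : ∀ j, (z j : ℕ) % 2 = (w j : ℕ) % 2 := by
      intro j
      have := congrFun (finFunctionFinEquiv.injective hzw) j
      simpa [par] using this
    obtain ⟨j, hj⟩ := Function.ne_iff.1 hne
    rw [Set.disjoint_left]
    rintro y ⟨-, hy⟩ ⟨-, hy'⟩
    rw [hrat, Set.mem_preimage, Metric.mem_closedBall, dist_pi_le_iff (by positivity)] at hy hy'
    have h1 := hy j
    have h2 := hy' j
    rw [Real.dist_eq, abs_le] at h1 h2
    simp only [center] at h1 h2
    have hp := hpar j
    have hj' : (z j : ℕ) ≠ w j := fun h' => hj (Fin.ext h')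
    rcases Nat.lt_or_gt_of_ne hj' with hlt | hlt
    · have h3 : ((z j : ℕ) : ℝ) + 2 ≤ (w j : ℕ) := by
        have : (z j : ℕ) + 2 ≤ w j := by omega
        exact_mod_cast this
      have h4 : (((z j : ℕ) : ℝ) + 2) * η ≤ (w j : ℕ) * η := mul_le_mul_of_nonneg_right h3 hη0.le
      nlinarith
    · have h3 : ((w j : ℕ) : ℝ) + 2 ≤ (z j : ℕ) := by
        have : (w j : ℕ) + 2 ≤ z j := by omega
        exact_mod_cast this
      have h4 : (((w j : ℕ) : ℝ) + 2) * η ≤ (z j : ℕ) * η := mul_le_mul_of_nonneg_right h3 hη0.le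
      nlinarith
  · have hcen : center z ∈ Metric.closedBall c (2 * r : ℝ) :=
      hin z (Metric.mem_closedBall_self (by rw [hrat]; positivity))
    obtain ⟨y, hy⟩ := hleb _ hcen
    refine ⟨h.symm y, hsymm y y.2, ?_⟩
    rintro x ⟨hxs, hx⟩
    have hx' : h x ∈ Metric.ball (center z) δ :=
      Metric.closedBall_subset_ball (by rw [hrat]; linarith) hx
    have := interior_subset (hy hx')
    rwa [Set.mem_preimage, h.left_inv hxs] at this

/-- Every neighbourhood of `p` contains a closed cube around `p`. The factor `3` leaves room for
moving the centre by `q / 2` and doubling the half-side. -/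
theorem exists_chartBox_subset {d : ℕ} {M : Type*} [TopologicalSpace M]
    (h : OpenPartialHomeomorph M (Fin d → ℝ)) {p : M} (hp : p ∈ h.source) {V : Set M}
    (hV : V ∈ nhds p) : ∃ q : ℚ, 0 < q ∧ Metric.closedBall (h p) (3 * q) ⊆ h.target ∧
      chartBox h (h p) (3 * q) ⊆ V := by
  have h1 : h.target ∩ h.symm ⁻¹' V ∈ nhds (h p) := by
    refine Filter.inter_mem (h.open_target.mem_nhds (h.map_source hp)) ?_
    apply (h.continuousAt_symm (h.map_source hp)).preimage_mem_nhds
    rwa [h.left_inv hp]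
  obtain ⟨s, hs, hsub⟩ := Metric.nhds_basis_closedBall.mem_iff.1 h1
  obtain ⟨q, hq0, hq⟩ := exists_rat_btwn (show (0 : ℝ) < s / 3 by positivity)
  have hqs : Metric.closedBall (h p) (3 * q : ℝ) ⊆ Metric.closedBall (h p) s :=
    Metric.closedBall_subset_closedBall (by linarith)
  refine ⟨q, by exact_mod_cast hq0, fun y hy => (hsub (hqs hy)).1, ?_⟩
  rintro x ⟨hxs, hx⟩
  have := (hsub (hqs hx)).2
  rwa [Set.mem_preimage, h.left_inv hxs] at this

/-! ### The tower away from short periodic orbits -/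

theorem homeomorph_zpow_mul_apply_eq_self {M : Type*} [TopologicalSpace M] (φ : M ≃ₜ M) {u : ℤ}
    {x : M} (h : (φ ^ u) x = x) (k : ℤ) : (φ ^ (u * k)) x = x := by
  induction k using Int.induction_on with
  | zero => simp
  | succ k ih => rw [mul_add, mul_one, homeomorph_zpow_add_apply, h, ih]
  | pred k ih =>
    rw [mul_sub, mul_one]
    exact homeomorph_zpow_sub_apply_eq φ (ih.trans h.symm)

/-- A periodic point reaches any other point of its orbit within one period. -/
theorem exists_zpow_apply_eq_of_periodic {M : Type*} [TopologicalSpace M] (φ : M ≃ₜ M) {u : ℤ}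
    (hu : u ≠ 0) {x : M} (h : (φ ^ u) x = x) (i : ℤ) :
    ∃ j : ℤ, |j| ≤ |u| ∧ (φ ^ j) x = (φ ^ i) x := by
  refine ⟨i % u, ?_, ?_⟩
  · rw [abs_of_nonneg (Int.emod_nonneg i hu)]
    exact (Int.emod_lt_abs i hu).le
  · conv_rhs => rw [← Int.emod_add_mul_ediv i u]
    rw [homeomorph_zpow_add_apply, homeomorph_zpow_mul_apply_eq_self φ h]

/-- Finitely many points whose orbit segments are pairwise disjoint have a neighbourhood with
separated iterates, every connected part of which lies near one of the points. -/
theorem exists_isOpen_separatedIterates {M : Type*} [TopologicalSpace M] [T2Space M] (φ : M ≃ₜ M)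
    (n : ℕ) {Q : Set M} (hQf : Q.Finite)
    (hQ : ∀ a ∈ Q, ∀ b ∈ Q, ∀ u : ℤ, |u| ≤ n → (φ ^ u) a = b → u = 0 ∧ a = b)
    (V : M → Set M) (hVo : ∀ a, IsOpen (V a)) (hV : ∀ a, a ∈ V a) :
    ∃ G : Set M, IsOpen G ∧ Q ⊆ G ∧ SeparatedIterates φ n G ∧ (∀ x ∈ G, ∃ a ∈ Q, x ∈ V a) ∧
      ∀ S ⊆ G, IsPreconnected S → S.Nonempty → ∃ a ∈ Q, S ⊆ V a := by
  have hfin : (⋃ u ∈ Set.Icc (-n : ℤ) n, (φ ^ u) '' Q).Finite :=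
    (Set.finite_Icc _ _).biUnion fun u _ => hQf.image _
  obtain ⟨T, hT, hTd⟩ := hfin.t2_separation
  have hmem : ∀ a ∈ Q, ∀ u : ℤ, |u| ≤ n → (φ ^ u) a ∈ ⋃ u ∈ Set.Icc (-n : ℤ) n, (φ ^ u) '' Q :=
    fun a ha u hu => Set.mem_iUnion₂.2 ⟨u, abs_le.1 hu, a, ha, rfl⟩
  let g : M → Set M := fun a => V a ∩ ⋂ u ∈ Set.Icc (-n : ℤ) n, (φ ^ u) ⁻¹' T ((φ ^ u) a)
  have hgo : ∀ a, IsOpen (g a) := fun a => (hVo a).inter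
    ((Set.finite_Icc _ _).isOpen_biInter fun u _ => (hT _).2.preimage (φ ^ u).continuous)
  have hga : ∀ a, a ∈ g a := fun a => ⟨hV a, Set.mem_iInter₂.2 fun u _ => (hT _).1⟩
  have hsep : ∀ a ∈ Q, ∀ b ∈ Q, ∀ u : ℤ, |u| ≤ n → ∀ x ∈ g a, (φ ^ u) x ∈ g b →
      u = 0 ∧ a = b := by
    intro a ha b hb u hu x hx hx'
    apply hQ a ha b hb u hu
    by_contra hne
    have h1 := Set.mem_iInter₂.1 hx.2 u (abs_le.1 hu)
    have h2 := Set.mem_iInter₂.1 hx'.2 0 (by simp)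
    have h3 := hmem b hb 0 (by simp)
    simp only [zpow_zero, Set.mem_preimage, Homeomorph.one_apply] at h2 h3
    exact Set.disjoint_left.1 (hTd (hmem a ha u hu) h3 hne) h1 h2
  refine ⟨⋃ a ∈ Q, g a, isOpen_biUnion fun a _ => hgo a,
    fun a ha => Set.mem_biUnion ha (hga a), ?_, ?_, ?_⟩
  · intro u hu hun x hx hx'
    obtain ⟨a, ha, hxa⟩ := Set.mem_iUnion₂.1 hx
    obtain ⟨b, hb, hxb⟩ := Set.mem_iUnion₂.1 hx'
    exact hu (hsep a ha b hb u hun x hxa hxb).1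
  · intro x hx
    obtain ⟨a, ha, hxa⟩ := Set.mem_iUnion₂.1 hx
    exact ⟨a, ha, hxa.1⟩
  · rintro S hS hSp ⟨x, hx⟩
    obtain ⟨a, ha, hxa⟩ := Set.mem_iUnion₂.1 (hS hx)
    refine ⟨a, ha, Set.Subset.trans ?_ (Set.inter_subset_left : g a ⊆ V a)⟩
    refine hSp.subset_left_of_subset_union (hgo a)
      (isOpen_biUnion fun b (_ : b ∈ {b | b ∈ Q ∧ b ≠ a}) => hgo b) ?_ ?_ ⟨x, hx, hxa⟩
    · simp only [Set.disjoint_iUnion_right]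
      intro b hb
      rw [Set.disjoint_left]
      intro y hya hyb
      exact hb.2 (hsep a ha b hb.1 0 (by simp) y hya (by simpa using hyb)).2.symm
    · intro y hy
      obtain ⟨b, hb, hyb⟩ := Set.mem_iUnion₂.1 (hS hy)
      by_cases hba : b = a
      · exact Or.inl (hba ▸ hyb)
      · exact Or.inr (Set.mem_iUnion₂.2 ⟨b, ⟨hb, hba⟩, hyb⟩)

/-- Finitely many periodic points of period greater than `n` have finitely many representatives of
their orbits, whose orbit segments of length `n` are pairwise disjoint. -/
theorem exists_orbit_representatives {M : Type*} [TopologicalSpace M] (φ : M ≃ₜ M) (m n : ℕ)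
    {Q : Set M} (hQf : Q.Finite) (hper : ∀ x ∈ Q, ∃ u : ℤ, u ≠ 0 ∧ |u| ≤ m ∧ (φ ^ u) x = x)
    (hQn : ∀ x ∈ Q, ∀ u : ℤ, u ≠ 0 → |u| ≤ n → (φ ^ u) x ≠ x) :
    ∃ Q₀ ⊆ {x | ∃ y ∈ Q, ∃ i : ℤ, (φ ^ i) y = x}, Q₀.Finite ∧
      (∀ a ∈ Q₀, ∀ b ∈ Q₀, ∀ u : ℤ, |u| ≤ n → (φ ^ u) a = b → u = 0 ∧ a = b) ∧
      ∀ x ∈ Q, ∃ i : ℤ, |i| ≤ m ∧ (φ ^ i) x ∈ Q₀ := by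
  let s : Setoid M :=
    { r := fun x y => ∃ i : ℤ, (φ ^ i) x = y
      iseqv :=
        { refl := fun x => ⟨0, by simp⟩
          symm := by
            rintro x y ⟨i, rfl⟩
            exact ⟨-i, by rw [← homeomorph_zpow_add_apply]; simp⟩
          trans := by
            rintro x y z ⟨i, rfl⟩ ⟨j, rfl⟩
            exact ⟨j + i, homeomorph_zpow_add_apply φ j i x⟩ } }
  let rep : M → M := fun x => (Quotient.mk s x).out
  have hrep : ∀ x, ∃ i : ℤ, (φ ^ i) x = rep x := fun x => s.symm (Quotient.mk_out (s := s) x)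
  have hrep' : ∀ x y, (∃ i : ℤ, (φ ^ i) x = y) → rep x = rep y := fun x y h =>
    congrArg Quotient.out (Quotient.sound (s := s) h)
  refine ⟨rep '' Q, ?_, hQf.image _, ?_, ?_⟩
  · rintro _ ⟨x, hx, rfl⟩
    exact ⟨x, hx, hrep x⟩
  · rintro _ ⟨x, hx, rfl⟩ _ ⟨y, hy, rfl⟩ u hu huxy
    have hxy : rep x = rep y := by
      have h1 := hrep' _ _ (hrep x)
      have h2 := hrep' _ _ (hrep y)
      have h3 := hrep' _ _ ⟨u, huxy⟩
      rw [h1, h2, h3]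
    refine ⟨?_, hxy⟩
    by_contra hu0
    obtain ⟨i, hi⟩ := hrep x
    refine hQn x hx u hu0 hu ?_
    rw [← hxy, ← hi, ← homeomorph_zpow_add_apply, add_comm, homeomorph_zpow_add_apply] at huxy
    exact (φ ^ i).injective huxy
  · intro x hx
    obtain ⟨i, hi⟩ := hrep x
    obtain ⟨u, hu0, hum, hux⟩ := hper x hx
    obtain ⟨j, hj, hji⟩ := exists_zpow_apply_eq_of_periodic φ hu0 hux i
    exact ⟨j, hj.trans hum, hji.trans hi ▸ ⟨x, hx, rfl⟩⟩

/-- The total length of the time windows of the `2 ^ d` colours. In the window of one colour, the at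
most `d * (2 ^ d + 1)` visits to the base exclude `2 * N + 1` times each; the remaining `N + 1`
separate consecutive windows. -/
def towerTime (d N : ℕ) : ℕ := 2 ^ d * (d * (2 ^ d + 1) * (2 * N + 1) + N + 1)

/-- A base with small components and separated iterates is visited, within bounded time, by all
orbits of a compact set without points of period at most `N`, if there are only finitely many points
of somewhat larger period. -/
theorem exists_tower_base {d : ℕ} {M : Type*} [EMetricSpace M] [CompactSpace M]
    [ChartedSpace (EuclideanSpace ℝ (Fin d)) M] [IsManifold (𝓡 d) 1 M] (φ : M ≃ₜ M)
    (hφ : ∀ i : ℤ, ContMDiff (𝓡 d) (𝓡 d) 1 (φ ^ i : M ≃ₜ M)) (N : ℕ) {K Y : Set M}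
    (hKc : IsClosed K) (hK : ∀ i : ℤ, ∀ x ∈ K, (φ ^ i) x ∈ K) (hYc : IsClosed Y) (hYK : Y ⊆ K)
    (hper : {x ∈ K | ∃ u : ℤ, u ≠ 0 ∧ |u| ≤ (2 * (towerTime d N + N) : ℕ) ∧ (φ ^ u) x = x}.Finite)
    (hYN : ∀ x ∈ Y, ∀ u : ℤ, u ≠ 0 → |u| ≤ N → (φ ^ u) x ≠ x) {ε : ENNReal} (hε : 0 < ε) :
    ∃ U : Set M, IsOpen U ∧ SeparatedIterates φ N (closure U) ∧
      (∀ S ⊆ closure U, IsPreconnected S → Metric.ediam S ≤ ε) ∧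
      ∀ x ∈ Y, ∃ i : ℤ, |i| ≤ (2 * (towerTime d N + N) : ℕ) ∧ (φ ^ i) x ∈ U := by
  classical
  set L := towerTime d N with hL
  set R := 2 * (L + N) with hR
  set Per := {x ∈ K | ∃ u : ℤ, u ≠ 0 ∧ |u| ≤ R ∧ (φ ^ u) x = x} with hPer
  have hε2 : 0 < ε / 2 := ENNReal.half_pos hε.ne'
  have hball : ∀ a : M, Metric.ediam (Metric.eball a (ε / 2)) ≤ ε := fun a =>
    Metric.ediam_eball_le.trans (by rw [ENNReal.mul_div_cancel two_ne_zero ENNReal.ofNat_ne_top])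
  -- Neighbourhood of representatives of the orbits of intermediate period.
  obtain ⟨Q₀, hQ₀orb, hQ₀f, hQ₀sep, hQ₀hit⟩ := exists_orbit_representatives φ R N
    (Q := {x ∈ Per | ∀ u : ℤ, u ≠ 0 → |u| ≤ N → (φ ^ u) x ≠ x}) (hper.subset (Set.sep_subset _ _))
    (fun x hx => hx.1.2) (fun x hx => hx.2)
  obtain ⟨G, hGo, hQ₀G, hGsep, hGV, hGconn⟩ := exists_isOpen_separatedIterates φ N hQ₀f hQ₀sep
    (fun a => Metric.eball a (ε / 2) ∩ (Per \ {a})ᶜ)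
    (fun a => Metric.isOpen_eball.inter (hper.subset Set.sdiff_subset).isClosed.isOpen_compl)
    (fun a => ⟨Metric.mem_eball_self hε2, fun h => h.2 rfl⟩)
  have hGPer : ∀ x ∈ G, x ∈ Per → x ∈ Q₀ := by
    intro x hxG hxP
    obtain ⟨a, ha, -, hxa⟩ := hGV x hxG
    by_cases hxa' : x = a
    · exact hxa' ▸ ha
    · exact absurd ⟨hxP, hxa'⟩ hxa
  obtain ⟨A, hAo, hQ₀A, hAG⟩ := normal_exists_closure_subset hQ₀f.isClosed hGo hQ₀G
  -- The compact set to be covered by boxes contains no point of period at most `R`.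
  set X := (frontier A ∩ K) ∪ (Y \ ⋃ i ∈ Set.Icc (-R : ℤ) R, (φ ^ i) ⁻¹' A) with hX
  have hXc : IsClosed X := by
    refine (isClosed_frontier.inter hKc).union (hYc.sdiff ?_)
    exact isOpen_biUnion fun i _ => hAo.preimage (φ ^ i).continuous
  have hXK : X ⊆ K := Set.union_subset Set.inter_subset_right (Set.sdiff_subset.trans hYK)
  have hXPer : ∀ x ∈ X, ∀ u : ℤ, u ≠ 0 → |u| ≤ R → (φ ^ u) x ≠ x := by
    intro x hx u hu huR hux
    have hxP : x ∈ Per := ⟨hXK hx, u, hu, huR, hux⟩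
    rcases hx with hx | hx
    · rw [hAo.frontier_eq] at hx
      exact hx.1.2 (hQ₀A (hGPer x (hAG hx.1.1) hxP))
    · obtain ⟨i, hi, hix⟩ := hQ₀hit x ⟨hxP, hYN x hx.1⟩
      exact hx.2 (Set.mem_iUnion₂.2 ⟨i, abs_le.1 hi, hQ₀A hix⟩)
  have hbox : ∀ x : M, ∃ q : ℚ, x ∈ X → 0 < q ∧
      Metric.closedBall (cubeChart d x x) (3 * q) ⊆ (cubeChart d x).target ∧
      SeparatedIterates φ R (chartBox (cubeChart d x) (cubeChart d x x) (3 * q)) ∧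
      (∀ i : ℤ, 0 ≤ i → i ≤ L →
        Metric.ediam ((φ ^ i) '' chartBox (cubeChart d x) (cubeChart d x x) (3 * q)) ≤ ε) ∧
      (x ∈ G → chartBox (cubeChart d x) (cubeChart d x x) (3 * q) ⊆ G) ∧
      (x ∉ G → Disjoint (chartBox (cubeChart d x) (cubeChart d x x) (3 * q)) (closure A)) := by
    intro x
    by_cases hx : x ∈ X
    swap
    · exact ⟨1, fun h => absurd h hx⟩
    obtain ⟨V, hVo, hxV, hVsep, -, -⟩ := exists_isOpen_separatedIterates φ R
      (Set.finite_singleton x) (by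
        rintro a rfl b rfl u hu hux
        by_contra hcon
        exact hXPer _ hx u (fun h => hcon ⟨h, rfl⟩) hu hux) (fun _ => Set.univ)
      (fun _ => isOpen_univ) (fun _ => trivial)
    have hV2o : IsOpen (⋂ i ∈ Set.Icc (0 : ℤ) L, (φ ^ i) ⁻¹' Metric.eball ((φ ^ i) x) (ε / 2)) :=
      (Set.finite_Icc _ _).isOpen_biInter fun i _ =>
        Metric.isOpen_eball.preimage (φ ^ i).continuous
    have hV3 : (if x ∈ G then G else (closure A)ᶜ) ∈ nhds x := by
      split_ifs with hxG
      · exact hGo.mem_nhds hxG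
      · exact isClosed_closure.isOpen_compl.mem_nhds fun h => hxG (hAG h)
    obtain ⟨q, hq0, hqt, hqV⟩ := exists_chartBox_subset (cubeChart d x) (mem_cubeChart_source x)
      (Filter.inter_mem (Filter.inter_mem (hVo.mem_nhds (hxV rfl)) (hV2o.mem_nhds
        (Set.mem_iInter₂.2 fun i _ => Metric.mem_eball_self hε2))) hV3)
    refine ⟨q, fun _ => ⟨hq0, hqt, hVsep.mono le_rfl fun y hy => (hqV hy).1.1, ?_, ?_, ?_⟩⟩
    · intro i hi0 hiL
      refine (Metric.ediam_mono ?_).trans (hball ((φ ^ i) x))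
      rintro _ ⟨y, hy, rfl⟩
      exact Set.mem_iInter₂.1 (hqV hy).1.2 i ⟨hi0, hiL⟩
    · intro hxG y hy
      have := (hqV hy).2
      rwa [if_pos hxG] at this
    · intro hxG
      rw [Set.disjoint_left]
      intro y hy
      have := (hqV hy).2
      rwa [if_neg hxG] at this
  choose q hq using hbox
  obtain ⟨t, htX, htcov⟩ := hXc.isCompact.elim_nhds_subcover
    (fun x => (cubeChart d x).source ∩ cubeChart d x ⁻¹' Metric.ball (cubeChart d x x) (q x / 2))
    (fun x hx => by
      refine ((cubeChart d x).isOpen_inter_preimage Metric.isOpen_ball).mem_nhds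
        ⟨mem_cubeChart_source x, Metric.mem_ball_self ?_⟩
      have : (0 : ℝ) < q x := by exact_mod_cast (hq x hx).1
      positivity)
  have hqpos : ∀ k : t, (0 : ℝ) < q k := fun k => by exact_mod_cast (hq k (htX k k.2)).1
  obtain ⟨c, hc, hgen⟩ := exists_generic_centers (fun i : ℤ => (φ ^ i : M ≃ₜ M)) hφ
    (fun k : t => (k : M)) (fun k => (q k : ℝ) / 2) (fun k => half_pos (hqpos k))
  have hcdist : ∀ k : t, dist (c k) (cubeChart d (k : M) k) ≤ q k / 2 := fun k =>
    (dist_pi_le_iff (half_pos (hqpos k)).le).2 fun j => by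
      rw [Real.dist_eq]; exact (hc k j).le
  -- Small boxes, whose interiors cover `X`, and the larger boxes containing their cells.
  let box : t → Set M := fun k => chartBox (cubeChart d (k : M)) (c k) (q k)
  let bigBox : t → Set M := fun k => chartBox (cubeChart d (k : M)) (c k) (2 * q k)
  have hcb : ∀ k : t, Metric.closedBall (c k) (2 * q k : ℝ) ⊆
      Metric.closedBall (cubeChart d (k : M) k) (3 * q k) := fun k =>
    Metric.closedBall_subset_closedBall' (by have := hcdist k; have := hqpos k; linarith)
  have hbig : ∀ k : t, bigBox k ⊆ chartBox (cubeChart d (k : M)) (cubeChart d (k : M) k) (3 * q k) :=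
    fun k => Set.inter_subset_inter_right _ (Set.preimage_mono (hcb k))
  have hbigc : ∀ k : t, IsClosed (bigBox k) := fun k =>
    isClosed_chartBox _ ((hcb k).trans (hq k (htX k k.2)).2.1)
  have hbigsep : ∀ k : t, SeparatedIterates φ R (bigBox k) := fun k =>
    (hq k (htX k k.2)).2.2.1.mono le_rfl (hbig k)
  have hXbox : ∀ x ∈ X, ∃ k : t, x ∈ interior (box k) := by
    intro x hx
    obtain ⟨k, hk, hxs, hxk⟩ := Set.mem_iUnion₂.1 (htcov hx)
    refine ⟨⟨k, hk⟩, subset_interior_chartBox _ _ _ ⟨hxs, ?_⟩⟩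
    rw [Set.mem_preimage, Metric.mem_ball] at hxk ⊢
    have h1 := hcdist ⟨k, hk⟩
    have h2 := dist_triangle_right (cubeChart d k x) (c ⟨k, hk⟩) (cubeChart d k k)
    simp only at h1
    linarith
  have hboxbig : ∀ k : t, box k ⊆ bigBox k := fun k => Set.inter_subset_inter_right _
    (Set.preimage_mono (Metric.closedBall_subset_closedBall (by have := hqpos k; linarith)))
  let B : t → Set M := fun k => gridHyperplanes (cubeChart d (k : M)) (c k)
  have hbigB : ∀ k : t, bigBox k \ interior (bigBox k) ⊆ B k := by
    intro k
    have := chartBox_diff_interior_subset (cubeChart d (k : M)) (c := c k) (c' := c k)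
      (r := 2 * q k) (by have := (hq k (htX k k.2)).1; positivity) (fun j => ⟨0, by simp⟩)
    simpa [bigBox, B] using this
  -- The initial base surrounds the representatives; its frontier in `K` consists of box faces.
  let W₀ : Set M := closure A ∪ ⋃ k ∈ {k : t | (k : M) ∈ G}, bigBox k
  let F₀ : t → Option (Fin (2 ^ d)) → Set M := fun k a =>
    if (k : M) ∈ G ∧ a = none then bigBox k \ interior (bigBox k) else ∅
  have hW₀G : W₀ ⊆ G := by
    refine Set.union_subset hAG (Set.iUnion₂_subset fun k hk => ?_)
    exact (hbig k).trans ((hq k (htX k k.2)).2.2.2.2.1 hk)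
  have hbase : IsTowerBase φ K N (2 ^ d) L ε B W₀ F₀ := by
    refine ⟨?_, hGsep.mono le_rfl hW₀G, ?_, ?_, ?_, ?_⟩
    · exact isClosed_closure.union ((Set.toFinite _).isClosed_biUnion fun k _ => hbigc k)
    · intro S hS hSp
      rcases S.eq_empty_or_nonempty with rfl | hne
      · simp
      · obtain ⟨a, -, ha⟩ := hGconn S (hS.trans hW₀G) hSp hne
        exact (Metric.ediam_mono (ha.trans Set.inter_subset_left)).trans (hball a)
    · intro x hxK hx hxi
      have hsub : ∀ k : t, (k : M) ∈ G → bigBox k ⊆ W₀ := fun k hk =>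
        (Set.subset_biUnion_of_mem (u := bigBox) (show k ∈ {k : t | (k : M) ∈ G} from hk)).trans
          Set.subset_union_right
      rcases hx with hx | hx
      · exfalso
        have hxA : x ∉ A := fun h => hxi (interior_maximal
          (subset_closure.trans Set.subset_union_left) hAo h)
        obtain ⟨k, hk⟩ := hXbox x (Or.inl ⟨by rw [hAo.frontier_eq]; exact ⟨hx, hxA⟩, hxK⟩)
        have hkG : (k : M) ∈ G := by
          by_contra hkG
          exact Set.disjoint_left.1 ((hq k (htX k k.2)).2.2.2.2.2 hkG)
            (hbig k (hboxbig k (interior_subset hk))) hx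
        exact hxi (interior_mono ((hboxbig k).trans (hsub k hkG)) hk)
      · obtain ⟨k, hk, hxk⟩ := Set.mem_iUnion₂.1 hx
        refine ⟨k, none, ?_⟩
        change x ∈ ite _ _ _
        rw [if_pos ⟨hk, rfl⟩]
        exact ⟨hxk, fun h => hxi (interior_mono (hsub k hk) h)⟩
    · intro k a x hx
      simp only [F₀] at hx
      split_ifs at hx with hka
      · exact ⟨0, by simpa using hbigB k hx⟩
      · exact hx.elim
    · intro k a
      simp only [F₀]
      split_ifs with hka
      · exact (hbigsep k).mono (by omega) Set.sdiff_subset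
      · exact fun u _ _ x hx => hx.elim
  have hstep : ∀ s : Finset t, ∃ (W : Set M) (F : t → Option (Fin (2 ^ d)) → Set M),
      IsTowerBase φ K N (2 ^ d) L ε B W F ∧ W₀ ⊆ W ∧ (∀ k ∉ s, ∀ a, F k (some a) = ∅) ∧
      ∀ k ∈ s, ∀ x ∈ box k, x ∈ K → ∃ i : ℤ, -N ≤ i ∧ i ≤ L + N ∧ (φ ^ i) x ∈ interior W := by
    intro s
    induction s using Finset.induction_on with
    | empty => exact ⟨W₀, F₀, hbase, subset_rfl, fun k _ a => by simp [F₀], fun k hk => by simp at hk⟩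
    | insert k s hks ih =>
      obtain ⟨W, F, hWF, hW, hFs, hcov⟩ := ih
      obtain ⟨W', F', hWF', hWW', hF', hcov'⟩ := hWF.exists_extension hKc (hL.trans rfl) hK hgen
        (k := k) (hasFineColoredCovers_chartBox (cubeChart d (k : M)) (hq k (htX k k.2)).1
          ((hcb k).trans (hq k (htX k k.2)).2.1)) (hbigsep k)
        (fun i h0 hi => (Metric.ediam_mono (Set.image_mono (hbig k))).trans
          ((hq k (htX k k.2)).2.2.2.1 i h0 hi)) (hFs k hks)
      refine ⟨W', F', hWF', hW.trans hWW', ?_, ?_⟩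
      · intro k' hk' a
        rw [Finset.mem_insert, not_or] at hk'
        rw [hF' k' hk'.1, hFs k' hk'.2]
      · intro k' hk' x hx hxK
        rcases Finset.mem_insert.1 hk' with rfl | hk'
        · exact hcov' x hx hxK
        · obtain ⟨i, h1, h2, h3⟩ := hcov k' hk' x hx hxK
          exact ⟨i, h1, h2, interior_mono hWW' h3⟩
  obtain ⟨W, F, hWF, hW, -, hcov⟩ := hstep Finset.univ
  have hUW : closure (interior W) ⊆ W := hWF.isClosed.closure_interior_subset
  refine ⟨interior W, isOpen_interior, hWF.separated.mono le_rfl hUW,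
    fun S hS hSp => hWF.ediam_le S (hS.trans hUW) hSp, fun x hx => ?_⟩
  by_cases hxA : x ∈ ⋃ i ∈ Set.Icc (-R : ℤ) R, (φ ^ i) ⁻¹' A
  · obtain ⟨i, hi, hix⟩ := Set.mem_iUnion₂.1 hxA
    exact ⟨i, abs_le.2 hi, interior_maximal
      ((subset_closure.trans Set.subset_union_left).trans hW) hAo hix⟩
  · obtain ⟨k, hk⟩ := hXbox x (Or.inr ⟨hx, hxA⟩)
    obtain ⟨i, h1, h2, h3⟩ := hcov k (Finset.mem_univ k) x (interior_subset hk) (hYK hx)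
    refine ⟨i, ?_, h3⟩
    rw [abs_le, hR]
    push_cast
    constructor <;> linarith

/-! ### Leaving a neighbourhood of the short periodic orbits -/

theorem homeomorph_zpow_natCast_apply {M : Type*} [TopologicalSpace M] (φ : M ≃ₜ M) (n : ℕ)
    (x : M) : (φ ^ (n : ℤ)) x = φ^[n] x := by
  induction n with
  | zero => simp
  | succ n ih =>
    rw [Function.iterate_succ_apply', ← ih, Nat.cast_succ, add_comm, homeomorph_zpow_add_apply,
      zpow_one]

theorem homeomorph_zpow_neg_natCast_apply {M : Type*} [TopologicalSpace M] (φ : M ≃ₜ M) (n : ℕ)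
    (x : M) : (φ ^ (-(n : ℤ))) x = φ.symm^[n] x := by
  rw [← homeomorph_zpow_natCast_apply, zpow_neg, ← inv_zpow]; rfl

/-- A finite invariant set has a neighbourhood such that an orbit staying in it from time `1` on
follows one orbit of the set from time `0` on. -/
theorem exists_nhds_forall_iterate_mem_imp_mem_localStableSet {M : Type*} [EMetricSpace M]
    (φ : M ≃ₜ M) {P : Set M} (hPf : P.Finite) (hP : ∀ p ∈ P, φ p ∈ P)
    (hP' : ∀ p ∈ P, φ.symm p ∈ P) {δ : ℝ} (hδ : 0 < δ) :
    ∃ V : Set M, IsOpen V ∧ P ⊆ V ∧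
      ∀ x, (∀ n : ℕ, 0 < n → φ^[n] x ∈ V) → ∃ p ∈ P, x ∈ localStableSet φ δ p := by
  have hδ' : 0 < ENNReal.ofReal δ := ENNReal.ofReal_pos.2 hδ
  obtain ⟨T, hT, hTd⟩ := hPf.t2_separation
  let g : M → Set M := fun p => T p ∩ φ ⁻¹' T (φ p) ∩ Metric.eball p (ENNReal.ofReal δ) ∩
    φ.symm ⁻¹' Metric.eball (φ.symm p) (ENNReal.ofReal δ)
  have hgo : ∀ p, IsOpen (g p) := fun p =>
    (((hT p).2.inter ((hT _).2.preimage φ.continuous)).inter Metric.isOpen_eball).inter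
      (Metric.isOpen_eball.preimage φ.symm.continuous)
  refine ⟨⋃ p ∈ P, g p, isOpen_biUnion fun p _ => hgo p, fun p hp => Set.mem_biUnion hp
    ⟨⟨⟨(hT p).1, (hT _).1⟩, Metric.mem_eball_self hδ'⟩, Metric.mem_eball_self hδ'⟩, ?_⟩
  intro x hx
  have hx' : ∀ n, ∃ p ∈ P, φ^[n + 1] x ∈ g p := fun n => by
    simpa using hx (n + 1) n.succ_pos
  obtain ⟨p, hp, hxp⟩ := hx' 0
  have hiter : ∀ n, φ^[n] p ∈ P := by
    intro n
    induction n with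
    | zero => exact hp
    | succ n ih => rw [Function.iterate_succ_apply']; exact hP _ ih
  have hfollow : ∀ n, φ^[n + 1] x ∈ g (φ^[n] p) := by
    intro n
    induction n with
    | zero => exact hxp
    | succ n ih =>
      obtain ⟨r, hr, hxr⟩ := hx' (n + 1)
      have h1 : φ^[n + 1 + 1] x ∈ T (φ^[n + 1] p) := by
        rw [Function.iterate_succ_apply' φ (n + 1) x, Function.iterate_succ_apply' φ n p]
        exact ih.1.1.2
      have hreq : r = φ^[n + 1] p := by
        by_contra hne
        exact Set.disjoint_left.1 (hTd hr (hiter (n + 1)) hne) hxr.1.1.1 h1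
      exact hreq ▸ hxr
  refine ⟨φ.symm p, hP' p hp, fun n => ?_⟩
  cases n with
  | zero =>
    have h0 : x ∈ Metric.eball (φ.symm p) (ENNReal.ofReal δ) := by simpa using (hfollow 0).2
    rw [Metric.mem_eball, edist_comm] at h0
    exact h0
  | succ n =>
    have h0 := (hfollow n).1.2
    rw [Metric.mem_eball, edist_comm] at h0
    rwa [Function.iterate_succ_apply φ n (φ.symm p), φ.apply_symm_apply]

theorem two_mul_towerTime_add_le (d : ℕ) {N : ℕ} (hN : 1 ≤ N) :
    2 * (towerTime d N + N) ≤ 2 * (2 ^ d * (3 * (d * (2 ^ d + 1)) + 2) + 1) * N := by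
  rw [towerTime]
  set H := d * (2 ^ d + 1)
  have h1 : H * (2 * N + 1) + N + 1 ≤ (3 * H + 2) * N := by nlinarith [Nat.mul_le_mul_left H hN]
  have h2 := Nat.mul_le_mul_left (2 ^ d) h1
  nlinarith

theorem mainTheorem9 (d : ℕ) :
    ∃ κ : ℕ,
      ∀ (M : Type*) [EMetricSpace M] [CompactSpace M]
        [ChartedSpace (EuclideanSpace ℝ (Fin d)) M] [IsManifold (𝓡 d) 1 M]
        (f : M ≃ₘ^1⟮𝓡 d, 𝓡 d⟯ M) (N₀ : ℕ) (δ : ℝ) (K : Set M),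
        0 < δ → IsCompact K → f '' K = K →
        (∀ x ∈ periodicPtsOfPeriodLE f K (κ * N₀), IsHyperbolicPeriodicPt (d := d) f x) →
        ∀ ε : ℝ, 0 < ε →
          ∃ U : Set M, IsOpen U ∧
            (∀ x ∈ K, x ∉ ⋃ p ∈ periodicPtsOfPeriodLE f K N₀, localStableSet f δ p →
              ∃ n : ℕ, 0 < n ∧ f^[n] x ∈ U) ∧
            (∀ x ∈ K, x ∉ ⋃ p ∈ periodicPtsOfPeriodLE f K N₀, localStableSet f.symm δ p →
              ∃ n : ℕ, 0 < n ∧ f.symm^[n] x ∈ U) ∧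
            (∀ i j : ℕ, i ≤ N₀ → j ≤ N₀ → i ≠ j →
              Disjoint (f^[i] '' closure U) (f^[j] '' closure U)) ∧
            (1 ≤ N₀ → ∀ x ∈ closure U,
              Metric.ediam (connectedComponentIn (closure U) x) ≤ ENNReal.ofReal ε) := by
  refine ⟨2 * (2 ^ d * (3 * (d * (2 ^ d + 1)) + 2) + 1), ?_⟩
  intro M _ _ _ _ f N δ K hδ hKc hfK hyp ε hε
  rcases Nat.eq_zero_or_pos N with rfl | hN
  · -- With `N₀ = 0` no disjointness is required.
    refine ⟨Set.univ, isOpen_univ, fun _ _ _ => ⟨1, one_pos, trivial⟩,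
      fun _ _ _ => ⟨1, one_pos, trivial⟩, fun i j hi hj hij => by omega, fun h => by omega⟩
  have hκ := two_mul_towerTime_add_le d hN
  set κ := 2 * (2 ^ d * (3 * (d * (2 ^ d + 1)) + 2) + 1)
  set φ : M ≃ₜ M := f.toHomeomorph with hφdef
  set R := 2 * (towerTime d N + N) with hR
  have hpow : ∀ (n : ℕ) (x : M), (φ ^ (n : ℤ)) x = f^[n] x := homeomorph_zpow_natCast_apply φ
  have hpow' : ∀ (n : ℕ) (x : M), (φ ^ (-(n : ℤ))) x = f.symm^[n] x :=
    homeomorph_zpow_neg_natCast_apply φ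
  have hφ : ∀ i : ℤ, ContMDiff (𝓡 d) (𝓡 d) 1 (φ ^ i : M ≃ₜ M) := by
    intro i
    obtain ⟨n, rfl | rfl⟩ := Int.eq_nat_or_neg i
    · rw [show ⇑(φ ^ (n : ℤ)) = f^[n] from funext (hpow n)]
      exact f.contMDiff.iterate n
    · rw [show ⇑(φ ^ (-(n : ℤ))) = f.symm^[n] from funext (hpow' n)]
      exact f.symm.contMDiff.iterate n
  have hK1 : ∀ x ∈ K, f x ∈ K := fun x hx => hfK ▸ Set.mem_image_of_mem f hx
  have hK2 : ∀ x ∈ K, f.symm x ∈ K := by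
    intro x hx
    rw [← hfK] at hx
    obtain ⟨y, hy, rfl⟩ := hx
    simpa using hy
  have hKn : ∀ (g : M → M), (∀ x ∈ K, g x ∈ K) → ∀ (n : ℕ), ∀ x ∈ K, g^[n] x ∈ K :=
    fun g hg n => Set.MapsTo.iterate hg n
  have hK : ∀ i : ℤ, ∀ x ∈ K, (φ ^ i) x ∈ K := by
    intro i x hx
    obtain ⟨n, rfl | rfl⟩ := Int.eq_nat_or_neg i
    · rw [hpow]; exact hKn f hK1 n x hx
    · rw [hpow']; exact hKn f.symm hK2 n x hx
  have hmem : ∀ (m : ℕ), ∀ x ∈ K, ∀ u : ℤ, u ≠ 0 → |u| ≤ m → (φ ^ u) x = x →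
      x ∈ periodicPtsOfPeriodLE f K m := by
    intro m x hx u hu hum hux
    have hper : Function.IsPeriodicPt f u.natAbs x := by
      have h1 : (φ ^ (u.natAbs : ℤ)) x = x := by
        rcases Int.natAbs_eq u with h | h
        · rw [← h]; exact hux
        · rw [show (u.natAbs : ℤ) = u * (-1) by omega]
          exact homeomorph_zpow_mul_apply_eq_self φ hux (-1)
      rwa [hpow] at h1
    have hpos : 0 < u.natAbs := Int.natAbs_pos.2 hu
    exact ⟨hx, ⟨_, hpos, hper⟩, (hper.minimalPeriod_le hpos).trans
      (by rw [Int.abs_eq_natAbs] at hum; omega)⟩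
  have hfin : (periodicPtsOfPeriodLE f K (κ * N)).Finite :=
    finite_periodicPtsOfPeriodLE f.contMDiff hKc hyp
  set P := periodicPtsOfPeriodLE f K N with hP
  have hPf : P.Finite := hfin.subset fun x hx => ⟨hx.1, hx.2.1, hx.2.2.trans (by omega)⟩
  have hPφ : ∀ i : ℤ, ∀ x ∈ P, (φ ^ i) x ∈ P := by
    rintro i x ⟨hxK, hxp, hxN⟩
    have hpos := Function.minimalPeriod_pos_of_mem_periodicPts hxp
    refine hmem N _ (hK i x hxK) (Function.minimalPeriod f x) (by omega)
      (by rw [abs_of_nonneg (by positivity)]; exact_mod_cast hxN) ?_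
    rw [← homeomorph_zpow_add_apply, add_comm, homeomorph_zpow_add_apply, hpow,
      Function.iterate_minimalPeriod]
  have hP1 : ∀ x ∈ P, φ x ∈ P := fun x hx => by simpa using hPφ 1 x hx
  have hP2 : ∀ x ∈ P, φ.symm x ∈ P := fun x hx => by simpa using hPφ (-1) x hx
  obtain ⟨V, hVo, hPV, hV⟩ :=
    exists_nhds_forall_iterate_mem_imp_mem_localStableSet φ hPf hP1 hP2 hδ
  obtain ⟨V', hVo', hPV', hV'⟩ :=
    exists_nhds_forall_iterate_mem_imp_mem_localStableSet φ.symm hPf hP2 hP1 hδ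
  -- The part of `K` away from `P`, spread along its orbits so that visits can be shifted in time.
  set Y : Set M := ⋃ i ∈ Set.Icc (-R : ℤ) R, (φ ^ i) '' (K \ (V ∩ V')) with hY
  have hYc : IsClosed Y := (Set.finite_Icc _ _).isClosed_biUnion fun i _ =>
    (φ ^ i).isClosedMap _ (hKc.isClosed.sdiff (hVo.inter hVo'))
  have hYK : Y ⊆ K := by
    refine Set.iUnion₂_subset fun i _ => ?_
    rintro _ ⟨x, hx, rfl⟩
    exact hK i x hx.1
  have hYN : ∀ x ∈ Y, ∀ u : ℤ, u ≠ 0 → |u| ≤ N → (φ ^ u) x ≠ x := by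
    intro x hx u hu huN hux
    obtain ⟨i, -, y, hy, rfl⟩ := Set.mem_iUnion₂.1 hx
    have hyP := hPφ (-i) _ (hmem N _ (hK i y hy.1) u hu huN hux)
    rw [← homeomorph_zpow_add_apply, neg_add_cancel, zpow_zero, Homeomorph.one_apply] at hyP
    exact hy.2 ⟨hPV hyP, hPV' hyP⟩
  obtain ⟨U, hUo, hUsep, hUε, hUhit⟩ := exists_tower_base φ hφ N hKc.isClosed hK hYc hYK
    (hfin.subset (by
      rintro x ⟨hxK, u, hu, huR, hux⟩
      exact hmem _ x hxK u hu (huR.trans (by exact_mod_cast hκ)) hux)) hYN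
    (ENNReal.ofReal_pos.2 hε)
  refine ⟨U, hUo, ?_, ?_, ?_, ?_⟩
  · intro x hxK hx
    obtain ⟨n, hn, hnV⟩ : ∃ n : ℕ, 0 < n ∧ φ^[n] x ∉ V := by
      by_contra hcon
      push Not at hcon
      obtain ⟨p, hp, hxp⟩ := hV x hcon
      exact hx (Set.mem_biUnion hp hxp)
    obtain ⟨i, hi, hiU⟩ := hUhit ((φ ^ (R : ℤ)) (f^[n] x)) (Set.mem_iUnion₂.2
      ⟨R, ⟨by omega, le_rfl⟩, f^[n] x, ⟨hKn f hK1 n x hxK, fun h => hnV h.1⟩, rfl⟩)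
    rw [← hpow n, ← homeomorph_zpow_add_apply, ← homeomorph_zpow_add_apply] at hiU
    rw [abs_le] at hi
    obtain ⟨m, hm⟩ := Int.eq_ofNat_of_zero_le (show 0 ≤ i + (R + n : ℤ) by omega)
    refine ⟨m, by omega, ?_⟩
    rwa [← hpow m, ← hm, ← add_assoc]
  · intro x hxK hx
    obtain ⟨n, hn, hnV⟩ : ∃ n : ℕ, 0 < n ∧ φ.symm^[n] x ∉ V' := by
      by_contra hcon
      push Not at hcon
      obtain ⟨p, hp, hxp⟩ := hV' x hcon
      exact hx (Set.mem_biUnion hp hxp)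
    obtain ⟨i, hi, hiU⟩ := hUhit ((φ ^ (-R : ℤ)) (f.symm^[n] x)) (Set.mem_iUnion₂.2
      ⟨-R, ⟨le_rfl, by omega⟩, f.symm^[n] x, ⟨hKn f.symm hK2 n x hxK, fun h => hnV h.2⟩, rfl⟩)
    rw [← hpow' n, ← homeomorph_zpow_add_apply, ← homeomorph_zpow_add_apply] at hiU
    rw [abs_le] at hi
    obtain ⟨m, hm⟩ := Int.eq_ofNat_of_zero_le (show 0 ≤ -(i + (-R + -n : ℤ)) by omega)
    refine ⟨m, by omega, ?_⟩
    rw [← hpow' m, ← hm, neg_neg]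
    convert hiU using 3
    ring
  · intro i j hi hj hij
    rw [Set.disjoint_left]
    rintro _ ⟨x, hx, rfl⟩ ⟨y, hy, hxy⟩
    rw [← hpow, ← hpow] at hxy
    have h1 := homeomorph_zpow_sub_apply_eq φ hxy
    refine hUsep (j - i) (by omega) ?_ y hy (h1 ▸ hx)
    rw [abs_le]
    constructor <;> omega
  · intro _ x _
    exact hUε _ (connectedComponentIn_subset _ _) isPreconnected_connectedComponentIn
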